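/- Let $d \ge 1$, $\mathbb{T}^d = \mathbb{R}^d/\mathbb{Z}^d$, and let $S : \mathbb{R}^d \times \mathbb{R}^d \to \mathbb{R}$ be a generating function, that is, a function of class $C^2$ such that $S(x+r,y+r) = S(x,y)$ for all $x,y \in \mathbb{R}^d$ and $r \in \mathbb{Z}^d$, and such that for some $A > 0$ $$\sum_{i,j} \frac{\partial^2 S}{\partial x_i \partial y_j}(x,y)\, \xi_i \xi_j \le -A \|\xi\|^2 \qquad \text{for all } x, y, \xi \in \mathbb{R}^d.$$ Write $\partial_1 S$ and $\partial_2 S$ for the differentials of $S$ with respect to its first and second variable. Let $\overline{F}$ be the bijection of $T^*\mathbb{R}^d = \mathbb{R}^d \times (\mathbb{R}^d)^*$ determined by $$\overline{F}(x,p) = (x',p') \iff p = -\partial_1 S(x,x') \text{ and } p' = \partial_2 S(x,x'),$$ and let $F : T^*\mathbb{T}^d \to T^*\mathbb{T}^d$ be the map (twist map) that it induces on the quotient. $F$ is said to be without conjugate points if, for all $\omega \in T^*\mathbb{T}^d$ and all $n \in \mathbb{Z} \setminus \{0\}$, $V(F^n(\omega)) \cap DF^n(\omega) \cdot V(\omega)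 = \{0\}$, where $V(\omega) \subset T_\omega T^*\mathbb{T}^d$ is the kernel of the differential at $\omega$ of the canonical projection $T^*\mathbb{T}^d \to \mathbb{T}^d$. A sequence $(x_n)_{n \in \mathbb{Z}}$ in $\mathbb{R}^d$ is said to be extremal if $\partial_2 S(x_{n-1},x_n) + \partial_1 S(x_n,x_{n+1}) = 0$ for all $n \in \mathbb{Z}$. Corollary 2.5. If $F$ is without conjugate points, then: (i) every constant sequence $(x_n)_{n \in \mathbb{Z}}$ in $\mathbb{R}^d$ is extremal; (ii) every extremal sequence is either injective or constant; (iii) for every $r \in \mathbb{Z}^d$, the quantity $S(x,x+r)$ does not depend on $x \in \mathbb{R}^d$. -/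

import Mathlib

open Topology

noncomputable section

namespace TwistMap

/-- The Euclidean space `ℝ^d`. -/
abbrev Space (d : ℕ) := EuclideanSpace ℝ (Fin d)

/-- The dual space `(ℝ^d)^*`. -/
abbrev Dual (d : ℕ) := StrongDual ℝ (Space d)

/-- The cotangent space `T^*ℝ^d = ℝ^d × (ℝ^d)^*`. -/
abbrev Cotangent (d : ℕ) := Space d × Dual d

/-- The inclusion `ℤ^d → ℝ^d`, as a group homomorphism. -/
def intVec (d : ℕ) : (Fin d → ℤ) →+ Space d where
  toFun r := WithLp.toLp 2 fun i => (r i : ℝ)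
  map_zero' := by ext i; simp
  map_add' r s := by ext i; simp

/-- The differential `∂₁S(x, y) ∈ (ℝ^d)^*` of `S` with respect to its first variable. -/
def partialOne {d : ℕ} (S : Space d × Space d → ℝ) (x y : Space d) : Dual d :=
  fderiv ℝ (fun x' => S (x', y)) x

/-- The differential `∂₂S(x, y) ∈ (ℝ^d)^*` of `S` with respect to its second variable. -/
def partialTwo {d : ℕ} (S : Space d × Space d → ℝ) (x y : Space d) : Dual d :=
  fderiv ℝ (fun y' => S (x, y')) y

/-- The bilinear form of mixed second derivatives: `mixed S x y η ξ` is
`∑ i j, ∂²S/∂x_i∂y_j (x, y) ξ_i η_j`. -/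
def mixed {d : ℕ} (S : Space d × Space d → ℝ) (x y : Space d) :
    Space d →L[ℝ] Space d →L[ℝ] ℝ :=
  fderiv ℝ (fun y' => partialOne S x y') y

/-- Generating functions: `C^2` functions `S` on `ℝ^d × ℝ^d`, invariant under the diagonal action
of `ℤ^d`, which satisfy the uniform twist condition. -/
structure IsGeneratingFunction {d : ℕ} (S : Space d × Space d → ℝ) : Prop where
  contDiff : ContDiff ℝ 2 S
  periodic : ∀ (r : Fin d → ℤ) (x y : Space d), S (x + intVec d r, y + intVec d r) = S (x, y)
  twist : ∃ A : ℝ, 0 < A ∧ ∀ x y ξ : Space d, mixed S x y ξ ξ ≤ -A * ‖ξ‖ ^ 2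

/-- A bi-infinite sequence in `ℝ^d` is extremal if
`∂₂S(x_{n-1}, x_n) + ∂₁S(x_n, x_{n+1}) = 0` for all `n`. -/
def IsExtremal {d : ℕ} (S : Space d × Space d → ℝ) (x : ℤ → Space d) : Prop :=
  ∀ n : ℤ, partialTwo S (x (n - 1)) (x n) + partialOne S (x n) (x (n + 1)) = 0

/-! Helper facts: the twist condition makes the partial differentials bijective. -/

theorem bijective_of_twist {d : ℕ} {f : Space d → Dual d} (hf : ContDiff ℝ 1 f) {A : ℝ}
    (hA : 0 < A) (h : ∀ x ξ, fderiv ℝ f x ξ ξ ≤ -A * ‖ξ‖ ^ 2) : Function.Bijective f := by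
  have hdiff : Differentiable ℝ f := hf.differentiable (by norm_num)
  have hmono : ∀ x y, A * ‖x - y‖ ^ 2 ≤ -((f x - f y) (x - y)) := by
    intro x y
    let g : ℝ → ℝ := fun t => f (y + t • (x - y)) (x - y)
    have hg : ∀ t, HasDerivAt g (fderiv ℝ f (y + t • (x - y)) (x - y) (x - y)) t := by
      intro t
      have h1 : HasDerivAt (fun t : ℝ => y + t • (x - y)) (x - y) t := by
        simpa using ((hasDerivAt_id t).smul_const (x - y)).const_add y
      have h2 := (hdiff (y + t • (x - y))).hasFDerivAt.comp_hasDerivAt t h1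
      simpa [g] using h2.clm_apply (hasDerivAt_const t (x - y))
    obtain ⟨c, -, hc⟩ := exists_hasDerivAt_eq_slope g _ (zero_lt_one' ℝ)
      (fun t _ => (hg t).continuousAt.continuousWithinAt) (fun t _ => hg t)
    have := h (y + c • (x - y)) (x - y)
    rw [hc] at this
    simp only [g, one_smul, zero_smul, add_zero, sub_zero, div_one, add_sub_cancel] at this
    simp only [sub_apply]
    linarith
  have hbound : ∀ x y, A * ‖x - y‖ ≤ ‖f x - f y‖ := by
    intro x y
    rcases eq_or_ne x y with rfl | hxy
    · simp
    have hpos : 0 < ‖x - y‖ := norm_pos_iff.2 (sub_ne_zero.2 hxy)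
    have h1 := (f x - f y).le_opNorm (x - y)
    have h2 := hmono x y
    have h3 := neg_le_abs ((f x - f y) (x - y))
    rw [Real.norm_eq_abs] at h1
    refine le_of_mul_le_mul_right ?_ hpos
    nlinarith
  refine ⟨fun x y hxy => ?_, ?_⟩
  · have := hbound x y
    rw [hxy, sub_self, norm_zero] at this
    have : ‖x - y‖ ≤ 0 := by nlinarith [norm_nonneg (x - y)]
    exact sub_eq_zero.1 (norm_le_zero_iff.1 this)
  · have hclosed : IsClosed (Set.range f) := by
      have hp : IsProperMap f := by
        rw [isProperMap_iff_tendsto_cocompact]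
        refine ⟨hf.continuous, ?_⟩
        rw [← Metric.cobounded_eq_cocompact, ← Metric.cobounded_eq_cocompact,
          ← tendsto_norm_atTop_iff_cobounded]
        have h1 : Filter.Tendsto (fun x : Space d => A * ‖x‖ - ‖f 0‖)
            (Bornology.cobounded (Space d)) Filter.atTop :=
          Filter.tendsto_atTop_add_const_right _ _
            (tendsto_norm_cobounded_atTop.const_mul_atTop hA)
        refine Filter.tendsto_atTop_mono (fun x => ?_) h1
        have h2 := hbound x 0
        have h3 := norm_sub_le (f x) (f 0)
        rw [sub_zero] at h2
        linarith
      exact hp.isClosedMap.isClosed_range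
    have hopen : IsOpen (Set.range f) := by
      refine IsOpenMap.isOpen_range (isOpenMap_iff_nhds_le.2 fun x => ?_)
      have hs : HasStrictFDerivAt f (fderiv ℝ f x) x :=
        hf.contDiffAt.hasStrictFDerivAt (by norm_num)
      refine (hs.map_nhds_eq_of_surj ?_).ge
      have hfin : Module.finrank ℝ (Space d) = Module.finrank ℝ (Dual d) :=
        (InnerProductSpace.toDual ℝ (Space d)).toLinearEquiv.finrank_eq
      rw [LinearMap.range_eq_top]
      refine (LinearMap.injective_iff_surjective_of_finrank_eq_finrank hfin).1 ?_
      refine (injective_iff_map_eq_zero _).2 fun ξ hξ => ?_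
      have h1 := h x ξ
      have hξ' : fderiv ℝ f x ξ = 0 := hξ
      rw [hξ', zero_apply] at h1
      by_contra hne
      have := norm_pos_iff.2 hne
      nlinarith [mul_pos hA (pow_pos this 2)]
    have := (isClopen_iff.1 ⟨hclosed, hopen⟩).resolve_left (Set.range_nonempty f).ne_empty
    exact Set.range_eq_univ.1 this

theorem partialOne_eq {d : ℕ} {S : Space d × Space d → ℝ} (hS : IsGeneratingFunction S)
    (x y : Space d) : partialOne S x y =
      (fderiv ℝ S (x, y)).comp (ContinuousLinearMap.inl ℝ (Space d) (Space d)) :=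
  (((hS.contDiff.differentiable (by norm_num)) (x, y)).hasFDerivAt.comp x
    (hasFDerivAt_prodMk_left x y)).fderiv

theorem partialTwo_eq {d : ℕ} {S : Space d × Space d → ℝ} (hS : IsGeneratingFunction S)
    (x y : Space d) : partialTwo S x y =
      (fderiv ℝ S (x, y)).comp (ContinuousLinearMap.inr ℝ (Space d) (Space d)) :=
  (((hS.contDiff.differentiable (by norm_num)) (x, y)).hasFDerivAt.comp y
    (hasFDerivAt_prodMk_right x y)).fderiv

theorem bijective_partialOne {d : ℕ} {S : Space d × Space d → ℝ} (hS : IsGeneratingFunction S)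
    (x : Space d) : Function.Bijective fun y => partialOne S x y := by
  obtain ⟨A, hA, h⟩ := hS.twist
  refine bijective_of_twist ?_ hA fun y ξ => h x y ξ
  simp only [partialOne_eq hS]
  have h1 : ContDiff ℝ 1 (fderiv ℝ S) := hS.contDiff.fderiv_right (by norm_num)
  exact (h1.comp (contDiff_const.prodMk contDiff_id)).clm_comp contDiff_const

theorem bijective_partialTwo {d : ℕ} {S : Space d × Space d → ℝ} (hS : IsGeneratingFunction S)
    (y : Space d) : Function.Bijective fun x => partialTwo S x y := by
  obtain ⟨A, hA, h⟩ := hS.twist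
  have h1 : ContDiff ℝ 1 (fderiv ℝ S) := hS.contDiff.fderiv_right (by norm_num)
  refine bijective_of_twist ?_ hA fun x ξ => ?_
  · simp only [partialTwo_eq hS]
    exact (h1.comp (contDiff_id.prodMk contDiff_const)).clm_comp contDiff_const
  · refine le_of_eq_of_le ?_ (h x y ξ)
    have h2 : HasFDerivAt (fderiv ℝ S) (fderiv ℝ (fderiv ℝ S) (x, y)) (x, y) :=
      (h1.differentiable (by norm_num) (x, y)).hasFDerivAt
    have hy : HasFDerivAt (fun y' => fderiv ℝ S (x, y')) _ y :=
      h2.comp y (hasFDerivAt_prodMk_right x y)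
    have hx : HasFDerivAt (fun x' => fderiv ℝ S (x', y)) _ x :=
      HasFDerivAt.comp (f := fun x' => (x', y)) x h2 (hasFDerivAt_prodMk_left x y)
    have hone := hy.clm_comp
      (hasFDerivAt_const (ContinuousLinearMap.inl ℝ (Space d) (Space d)) y)
    have htwo := hx.clm_comp
      (hasFDerivAt_const (ContinuousLinearMap.inr ℝ (Space d) (Space d)) x)
    have hsymm : IsSymmSndFDerivAt ℝ S (x, y) :=
      hS.contDiff.contDiffAt.isSymmSndFDerivAt (by simp)
    simp only [mixed, partialOne_eq hS, partialTwo_eq hS]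
    rw [hone.fderiv, htwo.fderiv]
    simpa using hsymm (ξ, 0) (0, ξ)

theorem partialOne_periodic {d : ℕ} {S : Space d × Space d → ℝ} (hS : IsGeneratingFunction S)
    (r : Fin d → ℤ) (x y : Space d) :
    partialOne S (x + intVec d r) (y + intVec d r) = partialOne S x y := by
  unfold partialOne
  rw [← fderiv_comp_add_right]
  simp only [hS.periodic]

theorem partialTwo_periodic {d : ℕ} {S : Space d × Space d → ℝ} (hS : IsGeneratingFunction S)
    (r : Fin d → ℤ) (x y : Space d) :
    partialTwo S (x + intVec d r) (y + intVec d r) = partialTwo S x y := by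
  unfold partialTwo
  rw [← fderiv_comp_add_right]
  simp only [hS.periodic]

/-- The bijection `y ↦ -∂₁S(x, y)` from `ℝ^d` to `(ℝ^d)^*`. -/
def equivOne {d : ℕ} {S : Space d × Space d → ℝ} (hS : IsGeneratingFunction S) (x : Space d) :
    Space d ≃ Dual d :=
  (Equiv.ofBijective (fun y => partialOne S x y) (bijective_partialOne hS x)).trans (Equiv.neg _)

/-- The bijection `x ↦ ∂₂S(x, y)` from `ℝ^d` to `(ℝ^d)^*`. -/
def equivTwo {d : ℕ} {S : Space d × Space d → ℝ} (hS : IsGeneratingFunction S) (y : Space d) :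
    Space d ≃ Dual d :=
  Equiv.ofBijective (fun x => partialTwo S x y) (bijective_partialTwo hS y)

theorem equivOne_apply {d : ℕ} {S : Space d × Space d → ℝ} (hS : IsGeneratingFunction S)
    (x y : Space d) : equivOne hS x y = -partialOne S x y := rfl

theorem equivTwo_apply {d : ℕ} {S : Space d × Space d → ℝ} (hS : IsGeneratingFunction S)
    (x y : Space d) : equivTwo hS y x = partialTwo S x y := rfl

/-- The twist map `T^*ℝ^d → T^*ℝ^d` generated by `S`; see `lift_eq_iff` for the implicit
relations that characterize it. -/
def lift {d : ℕ} {S : Space d × Space d → ℝ} (hS : IsGeneratingFunction S) :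
    Equiv.Perm (Cotangent d) where
  toFun z := ((equivOne hS z.1).symm z.2, partialTwo S z.1 ((equivOne hS z.1).symm z.2))
  invFun w := ((equivTwo hS w.1).symm w.2, -partialOne S ((equivTwo hS w.1).symm w.2) w.1)
  left_inv z := by
    simp only [← equivTwo_apply hS, ← equivOne_apply hS, Equiv.symm_apply_apply,
      Equiv.apply_symm_apply]
  right_inv w := by
    simp only [← equivTwo_apply hS, ← equivOne_apply hS, Equiv.symm_apply_apply,
      Equiv.apply_symm_apply]

theorem lift_eq_iff {d : ℕ} {S : Space d × Space d → ℝ} (hS : IsGeneratingFunction S)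
    (x x' : Space d) (p p' : Dual d) :
    lift hS (x, p) = (x', p') ↔ p = -partialOne S x x' ∧ p' = partialTwo S x x' := by
  simp only [lift, Equiv.coe_fn_mk, Prod.mk.injEq, Equiv.symm_apply_eq, equivOne_apply]
  constructor
  · rintro ⟨rfl, rfl⟩
    refine ⟨rfl, ?_⟩
    rw [← equivOne_apply hS, Equiv.symm_apply_apply]
  · rintro ⟨rfl, rfl⟩
    refine ⟨rfl, ?_⟩
    rw [← equivOne_apply hS, Equiv.symm_apply_apply]

theorem lift_add {d : ℕ} {S : Space d × Space d → ℝ} (hS : IsGeneratingFunction S)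
    (r : Fin d → ℤ) (z : Cotangent d) :
    lift hS (z + (intVec d r, 0)) = lift hS z + (intVec d r, 0) := by
  obtain ⟨x, p⟩ := z
  obtain ⟨⟨x', p'⟩, hw⟩ : ∃ w, lift hS (x, p) = w := ⟨_, rfl⟩
  rw [hw]
  simp only [Prod.mk_add_mk, add_zero]
  rw [lift_eq_iff] at hw ⊢
  rwa [partialOne_periodic hS, partialTwo_periodic hS]

theorem lift_symm_add {d : ℕ} {S : Space d × Space d → ℝ} (hS : IsGeneratingFunction S)
    (r : Fin d → ℤ) (z : Cotangent d) :
    (lift hS).symm (z + (intVec d r, 0)) = (lift hS).symm z + (intVec d r, 0) := by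
  rw [Equiv.symm_apply_eq, lift_add, Equiv.apply_symm_apply]

/-- The torus `𝕋^d = ℝ^d / ℤ^d`. -/
abbrev Torus (d : ℕ) := Space d ⧸ (intVec d).range

/-- The cotangent bundle `T^*𝕋^d = 𝕋^d × (ℝ^d)^*` of the torus. -/
abbrev CotangentTorus (d : ℕ) := Torus d × Dual d

/-- The covering map `T^*ℝ^d → T^*𝕋^d`. -/
def proj {d : ℕ} (z : Cotangent d) : CotangentTorus d := ((z.1 : Torus d), z.2)

/-- The map induced on `T^*𝕋^d` by a map of `T^*ℝ^d` that commutes with the integer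
translations. -/
def descend {d : ℕ} (g : Cotangent d → Cotangent d)
    (hg : ∀ (r : Fin d → ℤ) (z : Cotangent d), g (z + (intVec d r, 0)) = g z + (intVec d r, 0))
    (ω : CotangentTorus d) : CotangentTorus d :=
  Quotient.liftOn' ω.1 (fun x => proj (g (x, ω.2))) fun x y hxy => by
    obtain ⟨r, hr⟩ := QuotientAddGroup.leftRel_apply.1 hxy
    have hy : (y, ω.2) = (x, ω.2) + (intVec d r, 0) := by
      rw [hr]; simp
    show proj (g (x, ω.2)) = proj (g (y, ω.2))
    rw [hy, hg]
    simp only [proj, Prod.fst_add, Prod.snd_add, add_zero, Prod.mk.injEq, and_true]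
    exact QuotientAddGroup.eq.2 ⟨r, by simp⟩

theorem descend_proj {d : ℕ} (g : Cotangent d → Cotangent d)
    (hg : ∀ (r : Fin d → ℤ) (z : Cotangent d), g (z + (intVec d r, 0)) = g z + (intVec d r, 0))
    (z : Cotangent d) : descend g hg (proj z) = proj (g z) := rfl

theorem proj_surjective {d : ℕ} : Function.Surjective (proj (d := d)) := by
  rintro ⟨q, p⟩
  obtain ⟨x, rfl⟩ := QuotientAddGroup.mk_surjective q
  exact ⟨(x, p), rfl⟩

/-- The twist map `F : T^*𝕋^d → T^*𝕋^d` generated by `S`. -/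
def twistMap {d : ℕ} {S : Space d × Space d → ℝ} (hS : IsGeneratingFunction S) :
    Equiv.Perm (CotangentTorus d) where
  toFun := descend (lift hS) (lift_add hS)
  invFun := descend (lift hS).symm (lift_symm_add hS)
  left_inv ω := by
    obtain ⟨z, rfl⟩ := proj_surjective ω
    simp only [descend_proj, Equiv.symm_apply_apply]
  right_inv ω := by
    obtain ⟨z, rfl⟩ := proj_surjective ω
    simp only [descend_proj, Equiv.apply_symm_apply]

/-- `L` is the differential at `ω` of the map `G : T^*𝕋^d → T^*𝕋^d`. The smooth structure of
`T^*𝕋^d` is the one for which `proj` is a local diffeomorphism; through the differential of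
`proj`, every tangent space of `T^*𝕋^d` is canonically `ℝ^d × (ℝ^d)^*` (translations by `ℤ^d`
have differential the identity), so the differential of `G` is that of a local lift of `G`. -/
def HasDifferentialAt {d : ℕ} (G : CotangentTorus d → CotangentTorus d)
    (L : Cotangent d →L[ℝ] Cotangent d) (ω : CotangentTorus d) : Prop :=
  ∃ (g : Cotangent d → Cotangent d) (z : Cotangent d), proj z = ω ∧
    (∀ᶠ w in 𝓝 z, proj (g w) = G (proj w)) ∧ HasFDerivAt g L z

/-- The vertical space, that is the kernel of the differential `ℝ^d × (ℝ^d)^* → ℝ^d` of the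
canonical projection `T^*𝕋^d → 𝕋^d`; it is the same subspace at all points of `T^*𝕋^d` under the
canonical identification of the tangent spaces. -/
def vertical (d : ℕ) : Submodule ℝ (Cotangent d) :=
  LinearMap.ker (LinearMap.fst ℝ (Space d) (Dual d))

/-- `F` is without conjugate points: `V(F^n(ω)) ∩ DF^n(ω)·V(ω) = {0}` for all `ω ∈ T^*𝕋^d` and
all integers `n ≠ 0`. -/
def NoConjugatePoints {d : ℕ} {S : Space d × Space d → ℝ} (hS : IsGeneratingFunction S) : Prop :=
  ∀ (ω : CotangentTorus d) (n : ℤ), n ≠ 0 → ∀ L : Cotangent d →L[ℝ] Cotangent d,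
    HasDifferentialAt (⇑(twistMap hS ^ n)) L ω →
      vertical d ⊓ (vertical d).map (L : Cotangent d →ₗ[ℝ] Cotangent d) = ⊥

end TwistMap

end

/-! Extremal segments with fixed ends are the critical points of the action `∑ S(x_k, x_{k+1})` over
the interior points. The twist condition makes `S(x, y)` grow quadratically in `y - x`, so this
action is coercive (`tendsto_action_displace`). A vector in the kernel of its Hessian is a Jacobi
field vanishing at both ends, that is, a vertical vector which an iterate of `F` maps to a vertical
one. Without conjugate points the Hessian at every extremal segment is thus nondegenerate
(`hessian_orbit_nondegenerate`). Extremal segments of a given length are parametrized by their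
initial condition in the connected space `T^*ℝ^d`, and some minimizing segment has a semidefinite
Hessian, so all these Hessians are positive definite (`hessian_orbit_pos`). All critical points of
the action are then strict local minima, and a mountain pass argument leaves room for only one
(`eq_of_fderiv_eq_zero`). Hence extremal segments are determined by their ends and minimize the
action. For (iii), let `a` maximize and `b` minimize `S(x, x + r)`. The progression `a + k r` is
extremal, hence minimizing. Compared with the path that jumps to `b + k r`, follows it for a long
time and jumps back, it forces `S(a, a + r) ≤ S(b, b + r)`. Part (i) follows from the case `r = 0`
by differentiation. For (ii), a segment returning to its starting value has the ends of a constant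
segment, so it is constant, and the twist condition propagates this to the whole sequence. -/

noncomputable section

namespace TwistMap

/-! ### Mountain pass lemma, with connected sets in place of paths -/

section MountainPass

open Filter Set

variable {E : Type*} [NormedAddCommGroup E]

/-- The infimum of the levels at which two points lie in the same connected component of a
sublevel set of a proper function is attained. -/
theorem exists_connected_of_forall_level_gt [NormedSpace ℝ E] {f : E → ℝ}
    (hf : Continuous f) (hc : ∀ l, IsCompact {x | f x ≤ l}) {a b : E} {c : ℝ}
    (h : ∀ l, c < l → ∃ K, IsPreconnected K ∧ a ∈ K ∧ b ∈ K ∧ ∀ x ∈ K, f x < l) :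
    ∃ K, IsCompact K ∧ IsPreconnected K ∧ a ∈ K ∧ b ∈ K ∧ ∀ x ∈ K, f x ≤ c := by
  have hle : ∀ x, (∀ l, c < l → f x < l) → f x ≤ c := fun x hx =>
    le_of_forall_gt_imp_ge_of_dense fun l hl => (hx l hl).le
  have ha : f a ≤ c := hle a fun l hl => by
    obtain ⟨K, -, haK, -, hK⟩ := h l hl
    exact hK a haK
  have hb : f b ≤ c := hle b fun l hl => by
    obtain ⟨K, -, -, hbK, hK⟩ := h l hl
    exact hK b hbK
  have hcT : CompactSpace {x | f x ≤ c} := isCompact_iff_compactSpace.1 (hc c)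
  let a' : {x | f x ≤ c} := ⟨a, ha⟩
  let b' : {x | f x ≤ c} := ⟨b, hb⟩
  -- In a compact space components are intersections of clopen sets, so otherwise a clopen set
  -- separates `a` from `b` inside the sublevel set, and disjoint open sets `U`, `V` of `E` extend
  -- the separation.
  have hmem : b' ∈ connectedComponent a' := by
    by_contra hb'
    rw [connectedComponent_eq_iInter_isClopen, mem_iInter] at hb'
    push Not at hb'
    obtain ⟨⟨Z, hZ, haZ⟩, hbZ⟩ := hb'
    obtain ⟨U, V, hU, hV, hZU, hZV, hUV⟩ :=
      SeparatedNhds.of_isCompact_isCompact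
        (hZ.isClosed.isCompact.image continuous_subtype_val)
        (hZ.compl.isClosed.isCompact.image continuous_subtype_val)
        ((disjoint_image_iff Subtype.val_injective).2 disjoint_compl_right)
    have hsub : ∀ x, f x ≤ c → x ∈ U ∪ V := fun x hx => by
      by_cases hxZ : (⟨x, hx⟩ : {x | f x ≤ c}) ∈ Z
      · exact Or.inl (hZU ⟨_, hxZ, rfl⟩)
      · exact Or.inr (hZV ⟨_, hxZ, rfl⟩)
    -- By properness `U ∪ V` still covers a slightly higher sublevel set: `l` is the minimum of `f`
    -- on the uncovered part of `{f ≤ c + 1}`.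
    obtain ⟨l, hl, hlU⟩ : ∃ l, c < l ∧ ∀ x, f x < l → x ∈ U ∪ V := by
      have hD : IsCompact ({x | f x ≤ c + 1} \ (U ∪ V)) := (hc (c + 1)).diff (hU.union hV)
      rcases ({x | f x ≤ c + 1} \ (U ∪ V)).eq_empty_or_nonempty with hD0 | hD0
      · refine ⟨c + 1, by linarith, fun x hx => ?_⟩
        by_contra hxU
        exact (hD0 ▸ (⟨le_of_lt hx, hxU⟩ : x ∈ {x | f x ≤ c + 1} \ (U ∪ V)) : x ∈ (∅ : Set E))
      · obtain ⟨y, hy, hmin⟩ := hD.exists_isMinOn hD0 hf.continuousOn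
        have hyc : c < f y := lt_of_not_ge fun h' => hy.2 (hsub y h')
        refine ⟨f y, hyc, fun x hx => ?_⟩
        by_contra hxU
        exact absurd (hmin (⟨hx.le.trans hy.1, hxU⟩ : x ∈ {x | f x ≤ c + 1} \ (U ∪ V)))
          (not_le.2 hx)
    obtain ⟨K, hK, haK, hbK, hKl⟩ := h l hl
    have hKU : K ⊆ U := hK.subset_left_of_subset_union hU hV hUV
      (fun x hx => hlU x (hKl x hx)) ⟨a, haK, hZU ⟨a', haZ, rfl⟩⟩
    exact hUV.ne_of_mem (hKU hbK) (hZV ⟨b', hbZ, rfl⟩) rfl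
  refine ⟨Subtype.val '' connectedComponent a',
    isClosed_connectedComponent.isCompact.image continuous_subtype_val,
    isPreconnected_connectedComponent.image _ continuous_subtype_val.continuousOn,
    ⟨a', mem_connectedComponent, rfl⟩, ⟨b', hmem, rfl⟩, ?_⟩
  rintro _ ⟨x, -, rfl⟩
  exact x.2

variable [InnerProductSpace ℝ E] [FiniteDimensional ℝ E]

/-- A short step along the gradient decreases a `C^2` function, uniformly on compact sets. -/
theorem exists_gradient_step_lt {f : E → ℝ} (hf : ContDiff ℝ 2 f) {K : Set E}
    (hK : IsCompact K) :
    ∃ s : ℝ, ∀ x ∈ K, fderiv ℝ f x ≠ 0 → f (x - s • gradient f x) < f x := by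
  have hf1 : ContDiff ℝ 1 (fderiv ℝ f) := hf.fderiv_right (by norm_num)
  have hgc : Continuous (gradient f) :=
    (InnerProductSpace.toDual ℝ E).symm.continuous.comp hf1.continuous
  obtain ⟨R, hR⟩ := hK.isBounded.exists_norm_le
  obtain ⟨M, hM⟩ := (hK.image hgc).isBounded.exists_norm_le
  -- The radius leaves room for a step of length at most `M` from a point of `K`. With `s = 1 / (C +
  -- 1)`, the derivative along the gradient varies by at most `C * s * ‖g‖ ^ 2 < ‖g‖ ^ 2` during the
  -- step, so it stays positive.
  obtain ⟨C, hC⟩ := hf1.contDiffOn.exists_lipschitzOnWith (s := Metric.closedBall (0 : E) (R + M))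
    one_ne_zero (convex_closedBall _ _) (isCompact_closedBall _ _)
  refine ⟨1 / (C + 1), fun x hx hne => ?_⟩
  set s : ℝ := 1 / (C + 1) with hs
  have hCp : (0 : ℝ) < C + 1 := by positivity
  have hs0 : 0 < s := by positivity
  have hs1 : s ≤ 1 := by
    rw [hs, div_le_one hCp]
    have : (0 : ℝ) ≤ C := C.2
    linarith
  have hCs : C * s < 1 := by
    rw [hs, mul_one_div, div_lt_one hCp]
    linarith
  set g := gradient f x with hg
  have hgM : ‖g‖ ≤ M := hM _ ⟨x, hx, rfl⟩
  have hfg : fderiv ℝ f x g = ‖g‖ ^ 2 := by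
    rw [← real_inner_self_eq_norm_sq]
    exact (InnerProductSpace.toDual_symm_apply (x := g) (y := fderiv ℝ f x)).symm
  have hg0 : 0 < ‖g‖ := by
    rw [norm_pos_iff, hg, gradient]
    simpa using hne
  have hsg : ‖s • g‖ = s * ‖g‖ := by rw [norm_smul, Real.norm_of_nonneg hs0.le]
  obtain ⟨z, hz, hval⟩ := domain_mvt (f := f) (s := univ) (x := x) (y := x - s • g)
    (fun y _ => (hf.differentiable (by norm_num) y).hasFDerivAt.hasFDerivWithinAt)
    convex_univ (mem_univ _) (mem_univ _)
  have hzx : ‖z - x‖ ≤ s * ‖g‖ := by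
    have := norm_sub_le_of_mem_segment hz
    simpa [hsg] using this
  have hxR := hR x hx
  have hsgM : s * ‖g‖ ≤ M := by nlinarith
  have hdist := hC.dist_le_mul z (by
    rw [mem_closedBall_zero_iff]
    have := norm_add_le x (z - x)
    rw [add_sub_cancel] at this
    linarith) x (by
    rw [mem_closedBall_zero_iff]
    have := norm_nonneg g
    linarith)
  rw [dist_eq_norm, dist_eq_norm] at hdist
  have h1 := (fderiv ℝ f z - fderiv ℝ f x).le_opNorm g
  have h2 := neg_abs_le ((fderiv ℝ f z - fderiv ℝ f x) g)
  rw [Real.norm_eq_abs] at h1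
  have h3 : ‖fderiv ℝ f z - fderiv ℝ f x‖ ≤ C * s * ‖g‖ := by
    refine hdist.trans ?_
    rw [mul_assoc]
    exact mul_le_mul_of_nonneg_left hzx C.2
  have h4 : ‖fderiv ℝ f z - fderiv ℝ f x‖ * ‖g‖ ≤ C * s * ‖g‖ * ‖g‖ := by gcongr
  have h5 : 0 < fderiv ℝ f z g := by
    rw [sub_apply, hfg] at h2 h1
    nlinarith [mul_pos hg0 hg0]
  have h6 : x - s • g - x = -(s • g) := by abel
  rw [h6, map_neg, map_smul, smul_eq_mul] at hval
  nlinarith [mul_pos hs0 h5]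

/-- A proper `C^2` function all of whose critical points are strict local minima has at most one
critical point. -/
theorem eq_of_fderiv_eq_zero {f : E → ℝ} (hf : ContDiff ℝ 2 f)
    (hcoer : Tendsto f (cocompact E) atTop)
    (hmin : ∀ q, fderiv ℝ f q = 0 → ∀ᶠ x in 𝓝[≠] q, f q < f x) {a b : E}
    (ha : fderiv ℝ f a = 0) (hb : fderiv ℝ f b = 0) : a = b := by
  by_contra hab
  have hcomp : ∀ l, IsCompact {x | f x ≤ l} := fun l => by
    obtain ⟨t, ht, hts⟩ := mem_cocompact.1 (hcoer.eventually_gt_atTop l)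
    refine ht.of_isClosed_subset (isClosed_le hf.continuous continuous_const) fun x hx => ?_
    by_contra hxt
    exact absurd (show l < f x from hts hxt) (not_lt.2 hx)
  let levels : Set ℝ := {l | ∃ K, IsPreconnected K ∧ a ∈ K ∧ b ∈ K ∧ ∀ x ∈ K, f x ≤ l}
  have hbdd : BddBelow levels := ⟨f a, fun l ⟨K, _, haK, _, hK⟩ => hK a haK⟩
  have hne : levels.Nonempty := by
    have hseg : IsCompact (segment ℝ a b) := by
      rw [segment_eq_image_lineMap]
      exact isCompact_Icc.image AffineMap.lineMap_continuous
    obtain ⟨y, -, hy⟩ := hseg.exists_isMaxOn ⟨a, left_mem_segment ℝ a b⟩ hf.continuous.continuousOn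
    exact ⟨f y, segment ℝ a b, (convex_segment a b).isPreconnected, left_mem_segment ℝ a b,
      right_mem_segment ℝ a b, fun x hx => hy hx⟩
  obtain ⟨K, hKc, hKp, haK, hbK, hK⟩ :=
    exists_connected_of_forall_level_gt (c := sInf levels) hf.continuous hcomp fun l hl => by
      obtain ⟨l', ⟨K, h1, h2, h3, h4⟩, hl'⟩ := exists_lt_of_csInf_lt hne hl
      exact ⟨K, h1, h2, h3, fun x hx => (h4 x hx).trans_lt hl'⟩
  -- A strict local minimum at the top level of `K` would be an isolated point of `K`, against
  -- connectedness.
  have hreg : ∀ x ∈ K, fderiv ℝ f x = 0 → f x < sInf levels := fun x hx hx0 => by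
    refine lt_of_le_of_ne (hK x hx) fun hxc => ?_
    obtain ⟨U, hxU, hU, hUf⟩ : ∃ U, x ∈ U ∧ IsOpen U ∧ ∀ y ∈ U, y ≠ x → f x < f y := by
      have := hmin x hx0
      rw [eventually_nhdsWithin_iff, eventually_nhds_iff] at this
      obtain ⟨U, h1, h2, h3⟩ := this
      exact ⟨U, h3, h2, h1⟩
    have hother : (K ∩ {x}ᶜ).Nonempty := by
      by_cases hax : a = x
      · exact ⟨b, hbK, fun hbx => hab (hax.trans (Eq.symm hbx))⟩
      · exact ⟨a, haK, hax⟩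
    obtain ⟨y, hyK, hyU, hyx⟩ := hKp U {x}ᶜ hU isOpen_compl_singleton
      (fun y _ => by
        by_cases hyx : y = x
        · exact Or.inl (hyx ▸ hxU)
        · exact Or.inr hyx) ⟨x, hx, hxU⟩ hother
    have := hUf y hyU hyx
    have := hK y hyK
    linarith
  obtain ⟨s, hs⟩ := exists_gradient_step_lt hf hKc
  have hgc : Continuous fun x => x - s • gradient f x := by
    have : Continuous (gradient f) := (InnerProductSpace.toDual ℝ E).symm.continuous.comp
      (hf.continuous_fderiv (by norm_num))
    fun_prop
  have hfix : ∀ x, fderiv ℝ f x = 0 → x - s • gradient f x = x := fun x hx => by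
    simp [gradient, hx]
  have hlt : ∀ x ∈ K, f (x - s • gradient f x) < sInf levels := fun x hx => by
    by_cases hx0 : fderiv ℝ f x = 0
    · rw [hfix x hx0]
      exact hreg x hx hx0
    · exact (hs x hx hx0).trans_le (hK x hx)
  -- The gradient step fixes `a` and `b` and keeps `K` connected, while by compactness it brings `K`
  -- strictly below the optimal level.
  obtain ⟨y, hyK, hy⟩ := hKc.exists_isMaxOn ⟨a, haK⟩ (hf.continuous.comp hgc).continuousOn
  refine absurd (csInf_le hbdd (a := f (y - s • gradient f y)) ?_) (not_le.2 (hlt y hyK))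
  refine ⟨(fun x => x - s • gradient f x) '' K, hKp.image _ hgc.continuousOn,
    ⟨a, haK, hfix a ha⟩, ⟨b, hbK, hfix b hb⟩, ?_⟩
  rintro _ ⟨x, hx, rfl⟩
  exact hy hx

end MountainPass

/-! ### Second order conditions and positivity of bilinear forms -/

section SecondOrder

open Filter Set

variable {E : Type*} [NormedAddCommGroup E] [NormedSpace ℝ E]

/-- The second order expansion of a `C^2` function at a critical point. -/
theorem eventually_sub_secondDeriv_le {f : E → ℝ} (hf : ContDiff ℝ 2 f) {q : E}
    (hq : fderiv ℝ f q = 0) {ε : ℝ} (hε : 0 < ε) :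
    ∀ᶠ x in 𝓝 q, ∃ t : ℝ, 0 < t ∧
      |f x - f q - t * fderiv ℝ (fderiv ℝ f) q (x - q) (x - q)| ≤ t * (ε * ‖x - q‖ ^ 2) := by
  have hf1 : ContDiff ℝ 1 (fderiv ℝ f) := hf.fderiv_right (by norm_num)
  have h1 := ((hf1.differentiable one_ne_zero q).hasFDerivAt.isLittleO).def hε
  obtain ⟨δ, hδ, hball⟩ := Metric.eventually_nhds_iff_ball.1 h1
  filter_upwards [Metric.ball_mem_nhds q hδ] with x hx
  have hg : ∀ t : ℝ, HasDerivAt (fun t : ℝ => f (q + t • (x - q)))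
      (fderiv ℝ f (q + t • (x - q)) (x - q)) t := by
    intro t
    have h1 : HasDerivAt (fun t : ℝ => q + t • (x - q)) (x - q) t := by
      simpa using ((hasDerivAt_id t).smul_const (x - q)).const_add q
    exact (hf.differentiable (by norm_num) (q + t • (x - q))).hasFDerivAt.comp_hasDerivAt t h1
  -- A single use of the mean value theorem gives an unknown `t` in `(0, 1)` instead of Taylor's `1
  -- / 2`; only the sign of the expansion is needed later.
  obtain ⟨t, ht, hval⟩ := exists_hasDerivAt_eq_slope _ _ (zero_lt_one' ℝ)
    (fun t _ => (hg t).continuousAt.continuousWithinAt) (fun t _ => hg t)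
  simp only [one_smul, zero_smul, add_zero, sub_zero, div_one, add_sub_cancel] at hval
  refine ⟨t, ht.1, ?_⟩
  have hmem : q + t • (x - q) ∈ Metric.ball q δ := by
    rw [mem_ball_iff_norm] at hx ⊢
    rw [add_sub_cancel_left, norm_smul, Real.norm_of_nonneg ht.1.le]
    nlinarith [norm_nonneg (x - q), ht.2]
  have h2 := hball _ hmem
  rw [hq, sub_zero, add_sub_cancel_left, norm_smul, Real.norm_of_nonneg ht.1.le] at h2
  have h3 := (fderiv ℝ f (q + t • (x - q)) -
    fderiv ℝ (fderiv ℝ f) q (t • (x - q))).le_opNorm (x - q)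
  rw [← hval, ← Real.norm_eq_abs]
  simp only [map_smul, sub_apply, smul_apply, smul_eq_mul] at h2 h3
  refine h3.trans ?_
  calc _ ≤ ε * (t * ‖x - q‖) * ‖x - q‖ := by gcongr
    _ = _ := by ring

theorem secondDeriv_nonneg_of_forall_le {f : E → ℝ} (hf : ContDiff ℝ 2 f) {q : E}
    (hmin : ∀ x, f q ≤ f x) (v : E) : 0 ≤ fderiv ℝ (fderiv ℝ f) q v v := by
  by_contra! hneg
  have hq : fderiv ℝ f q = 0 := IsLocalMin.fderiv_eq_zero (Eventually.of_forall hmin)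
  set B := fderiv ℝ (fderiv ℝ f) q with hB
  -- With this error the negative term `B v v` loses at most half of its size.
  have hε : 0 < -B v v / (2 * (‖v‖ ^ 2 + 1)) := by
    have : 0 < -B v v := by linarith
    positivity
  have htend : Tendsto (fun s : ℝ => q + s • v) (𝓝[>] 0) (𝓝 q) := by
    have : Continuous fun s : ℝ => q + s • v := by fun_prop
    simpa using (this.tendsto 0).mono_left nhdsWithin_le_nhds
  obtain ⟨s, ⟨t, ht, hst⟩, hs⟩ := ((htend.eventually
    (eventually_sub_secondDeriv_le hf hq hε)).and self_mem_nhdsWithin).exists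
  replace hs : 0 < s := hs
  rw [add_sub_cancel_left, norm_smul, Real.norm_of_nonneg hs.le] at hst
  simp only [map_smul, smul_apply, smul_eq_mul, ← hB] at hst
  have h1 := (abs_le.1 hst).2
  have h2 := hmin (q + s • v)
  have h3 : -B v v / (2 * (‖v‖ ^ 2 + 1)) * ‖v‖ ^ 2 ≤ -B v v / 2 := by
    rw [div_mul_eq_mul_div, div_le_div_iff₀ (by positivity) (by positivity)]
    nlinarith [sq_nonneg ‖v‖]
  have hts : 0 < t * s ^ 2 := by positivity
  nlinarith

/-- Compactness of the unit sphere gives `α * ‖v‖ ^ 2 ≤ B v v` with `α > 0`, and an error of `α / 2`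
in the expansion preserves the sign. -/
theorem eventually_lt_of_secondDeriv_pos [FiniteDimensional ℝ E] {f : E → ℝ}
    (hf : ContDiff ℝ 2 f) {q : E} (hq : fderiv ℝ f q = 0)
    (hpos : ∀ v, v ≠ 0 → 0 < fderiv ℝ (fderiv ℝ f) q v v) :
    ∀ᶠ x in 𝓝[≠] q, f q < f x := by
  set B := fderiv ℝ (fderiv ℝ f) q with hB
  obtain ⟨α, hα, hBα⟩ : ∃ α : ℝ, 0 < α ∧ ∀ v, α * ‖v‖ ^ 2 ≤ B v v := by
    rcases (Metric.sphere (0 : E) 1).eq_empty_or_nonempty with h0 | h0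
    · refine ⟨1, one_pos, fun v => ?_⟩
      have : v = 0 := by
        by_contra hv
        exact (h0 ▸ (by simp [norm_smul, hv] : ‖v‖⁻¹ • v ∈ Metric.sphere (0 : E) 1) :
          ‖v‖⁻¹ • v ∈ (∅ : Set E))
      simp [this]
    · obtain ⟨u, hu, hmin⟩ := (isCompact_sphere (0 : E) 1).exists_isMinOn h0
        (f := fun v => B v v) (by fun_prop)
      refine ⟨B u u, hpos u (Metric.ne_of_mem_sphere hu one_ne_zero), fun v => ?_⟩
      rcases eq_or_ne v 0 with rfl | hv
      · simp
      have h1 : B u u ≤ B (‖v‖⁻¹ • v) (‖v‖⁻¹ • v) :=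
        hmin (by simp [norm_smul, hv] : ‖v‖⁻¹ • v ∈ Metric.sphere (0 : E) 1)
      simp only [map_smul, smul_apply, smul_eq_mul] at h1
      have hv' := norm_pos_iff.2 hv
      calc B u u * ‖v‖ ^ 2 ≤ (‖v‖⁻¹ * (‖v‖⁻¹ * B v v)) * ‖v‖ ^ 2 := by gcongr
        _ = B v v := by field_simp
  filter_upwards [nhdsWithin_le_nhds (eventually_sub_secondDeriv_le hf hq (half_pos hα)),
    self_mem_nhdsWithin] with x ⟨t, ht, hx⟩ hne
  have h1 := (abs_le.1 hx).1
  have h2 := hBα (x - q)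
  have h3 : 0 < ‖x - q‖ ^ 2 := by
    have := norm_pos_iff.2 (sub_ne_zero.2 hne)
    positivity
  nlinarith [mul_pos ht (mul_pos hα h3)]

/-- A symmetric positive semidefinite nondegenerate bilinear form is positive definite. -/
theorem pos_of_nonneg_of_nondegenerate (B : E →L[ℝ] E →L[ℝ] ℝ) (hsymm : ∀ u v, B u v = B v u)
    (hB : ∀ v, 0 ≤ B v v) (hnd : ∀ u, (∀ v, B u v = 0) → u = 0) {u : E} (hu : u ≠ 0) :
    0 < B u u := by
  refine lt_of_le_of_ne (hB u) fun h0 => hu (hnd u fun v => ?_)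
  by_contra hne
  -- As `B u u = 0`, the form is affine along `v + λ u`; this `λ` gives it the value `-1`.
  have h1 := hB (v + (-(B v v + 1) / (2 * B u v)) • u)
  simp only [map_add, map_smul, add_apply, smul_apply, smul_eq_mul, ← h0, hsymm v u] at h1
  have : -(B v v + 1) / (2 * B u v) * B u v = -(B v v + 1) / 2 := by field_simp
  rw [this] at h1
  linarith

/-- Along a connected family of symmetric nondegenerate bilinear forms, positivity persists. -/
theorem pos_of_preconnectedSpace [FiniteDimensional ℝ E] {Z : Type*} [TopologicalSpace Z]
    [PreconnectedSpace Z] (B : Z → E →L[ℝ] E →L[ℝ] ℝ)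
    (hcont : Continuous fun p : Z × E => B p.1 p.2 p.2) (hsymm : ∀ z u v, B z u v = B z v u)
    (hnd : ∀ z u, (∀ v, B z u v = 0) → u = 0) {z₀ : Z} (hz₀ : ∀ u, 0 ≤ B z₀ u u) (z : Z)
    {u : E} (hu : u ≠ 0) : 0 < B z u u := by
  -- `P` is closed, being defined by weak inequalities. It is open because nondegeneracy upgrades
  -- semidefinite to definite, which is stable by compactness of the sphere.
  set P : Set Z := {z | ∀ u, 0 ≤ B z u u} with hP
  have hpos : ∀ z ∈ P, ∀ u, u ≠ 0 → 0 < B z u u := fun z hz u hu =>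
    pos_of_nonneg_of_nondegenerate _ (hsymm z) hz (hnd z) hu
  have hclosed : IsClosed P := by
    rw [hP, Set.ofPred_forall]
    refine isClosed_iInter fun u => isClosed_le continuous_const ?_
    exact hcont.comp (Continuous.prodMk_left u)
  have hopen : IsOpen P := by
    refine isOpen_iff_mem_nhds.2 fun z₁ hz₁ => ?_
    have h := (isCompact_sphere (0 : E) 1).eventually_forall_of_forall_eventually
      (x₀ := z₁) (P := fun z u => 0 < B z u u) fun u hu =>
        (isOpen_lt continuous_const hcont).mem_nhds
          (hpos z₁ hz₁ u (Metric.ne_of_mem_sphere hu one_ne_zero))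
    filter_upwards [h] with z hz u
    rcases eq_or_ne u 0 with rfl | hu
    · simp
    have h1 := (hz (‖u‖⁻¹ • u) (by simp [norm_smul, hu])).le
    simp only [map_smul, smul_apply, smul_eq_mul] at h1
    have hu' := norm_pos_iff.2 hu
    have h2 : B z u u = ‖u‖ ^ 2 * (‖u‖⁻¹ * (‖u‖⁻¹ * B z u u)) := by field_simp
    rw [h2]
    positivity
  have huniv : P = Set.univ := IsClopen.eq_univ ⟨hclosed, hopen⟩ ⟨z₀, hz₀⟩
  exact hpos z (huniv ▸ Set.mem_univ z) u hu

end SecondOrder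

/-! ### The action functional: coercivity, critical points, Hessian -/

section Action

open Filter

variable {d : ℕ}

/-- A continuous `ℤ^d`-periodic function attains its maximum. -/
theorem exists_forall_le_of_periodic {f : Space d → ℝ} (hf : Continuous f)
    (hper : ∀ (r : Fin d → ℤ) (x : Space d), f (x + intVec d r) = f x) :
    ∃ x₀, ∀ x, f x ≤ f x₀ := by
  -- The ball of radius `√d` contains the unit cube, into which integer parts translate every point.
  obtain ⟨x₀, -, hx₀⟩ := (isCompact_closedBall (0 : Space d) (√d)).exists_isMaxOn
    ⟨0, by simp⟩ hf.continuousOn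
  refine ⟨x₀, fun x => ?_⟩
  set y : Space d := x + intVec d fun i => -⌊x i⌋ with hy
  have hyx : f y = f x := hper _ _
  rw [← hyx]
  refine hx₀ ?_
  rw [mem_closedBall_zero_iff, EuclideanSpace.norm_eq]
  refine Real.sqrt_le_sqrt ?_
  have : ∀ i ∈ Finset.univ, ‖y i‖ ^ 2 ≤ (1 : ℝ) := fun i _ => by
    have h1 : y i = Int.fract (x i) := by
      simp [hy, intVec, Int.fract, sub_eq_add_neg]
    rw [h1, Real.norm_of_nonneg (Int.fract_nonneg _)]
    exact pow_le_one₀ (Int.fract_nonneg _) (Int.fract_lt_one _).le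
  simpa using Finset.sum_le_sum this

variable {S : Space d × Space d → ℝ}

theorem IsGeneratingFunction.differentiable (hS : IsGeneratingFunction S) :
    Differentiable ℝ S :=
  hS.contDiff.differentiable (by norm_num)

theorem IsGeneratingFunction.contDiff_fderiv (hS : IsGeneratingFunction S) :
    ContDiff ℝ 1 (fderiv ℝ S) :=
  hS.contDiff.fderiv_right (by norm_num)

theorem mixed_apply (hS : IsGeneratingFunction S) (x y η ξ : Space d) :
    mixed S x y η ξ = fderiv ℝ (fderiv ℝ S) (x, y) (0, η) (ξ, 0) := by
  have h2 : HasFDerivAt (fderiv ℝ S) (fderiv ℝ (fderiv ℝ S) (x, y)) (x, y) :=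
    (hS.contDiff_fderiv.differentiable one_ne_zero (x, y)).hasFDerivAt
  have hy : HasFDerivAt (fun y' => fderiv ℝ S (x, y')) _ y :=
    h2.comp y (hasFDerivAt_prodMk_right x y)
  have hone := hy.clm_comp
    (hasFDerivAt_const (ContinuousLinearMap.inl ℝ (Space d) (Space d)) y)
  simp only [mixed, partialOne_eq hS]
  rw [hone.fderiv]
  simp

/-- The twist condition makes a generating function coercive in `y - x`. -/
theorem exists_norm_sub_le (hS : IsGeneratingFunction S) :
    ∃ C : ℝ, ∀ x y, ‖y - x‖ ≤ S (x, y) + C := by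
  obtain ⟨A, hA, htw⟩ := hS.twist
  have hp1 : Continuous fun z : Space d × Space d => partialOne S z.1 z.2 := by
    simp only [partialOne_eq hS]
    have := hS.contDiff_fderiv.continuous
    fun_prop
  obtain ⟨x₀, hx₀⟩ := exists_forall_le_of_periodic (f := fun x => -S (x, x))
    (by have := hS.contDiff.continuous; fun_prop) (fun r x => by simp only [hS.periodic])
  obtain ⟨x₁, hx₁⟩ := exists_forall_le_of_periodic (f := fun x => ‖partialOne S x x‖)
    (hp1.comp (continuous_id.prodMk continuous_id)).norm
    (fun r x => by simp only [partialOne_periodic hS])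
  set M := ‖partialOne S x₁ x₁‖ with hM
  -- The twist condition bounds the `t`-derivative of the left side by `-A * ‖v‖ ^ 2`, and `M`
  -- bounds its value on the diagonal.
  have hmono : ∀ x v : Space d, ∀ t : ℝ, 0 ≤ t →
      partialOne S x (x + t • v) v ≤ M * ‖v‖ - A * ‖v‖ ^ 2 * t := by
    intro x v t ht
    have hd : ∀ t : ℝ, HasDerivAt (fun t : ℝ => partialOne S x (x + t • v) v)
        (mixed S x (x + t • v) v v) t := by
      intro t
      have h1 : HasDerivAt (fun t : ℝ => x + t • v) v t := by
        simpa using ((hasDerivAt_id t).smul_const v).const_add x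
      have hdiff : DifferentiableAt ℝ (fun y => partialOne S x y) (x + t • v) := by
        simp only [partialOne_eq hS]
        have h := hS.contDiff_fderiv.differentiable one_ne_zero
        fun_prop
      have h2 := hdiff.hasFDerivAt.comp_hasDerivAt t h1
      simpa [mixed] using h2.clm_apply (hasDerivAt_const t v)
    have hanti : Antitone fun t : ℝ => partialOne S x (x + t • v) v + A * ‖v‖ ^ 2 * t :=
      antitone_of_hasDerivAt_nonpos
        (f' := fun t => mixed S x (x + t • v) v v + A * ‖v‖ ^ 2 * 1)
        (fun t => (hd t).add ((hasDerivAt_id t).const_mul (A * ‖v‖ ^ 2)))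
        (fun t => by have := htw x (x + t • v) v; dsimp only [Pi.zero_apply]; linarith)
    have h0 := hanti ht
    simp only [zero_smul, add_zero, mul_zero] at h0
    have h1 := (le_abs_self _).trans ((partialOne S x x).le_opNorm v)
    have h2 := mul_le_mul_of_nonneg_right (hx₁ x) (norm_nonneg v)
    linarith
  -- Integrate the previous bound while the first variable moves from `y` to `x`, starting on the
  -- diagonal, where `S` is at least `S (x₀, x₀)`.
  have hlow : ∀ x y : Space d,
      S (x₀, x₀) - M * ‖y - x‖ + A * ‖y - x‖ ^ 2 / 2 ≤ S (x, y) := by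
    intro x y
    set v := y - x with hv
    have hd : ∀ t : ℝ, HasDerivAt (fun t : ℝ => S (y - t • v, y))
        (-partialOne S (y - t • v) y v) t := by
      intro t
      have h1 : HasDerivAt (fun t : ℝ => y - t • v) (-v) t := by
        simpa using ((hasDerivAt_id t).smul_const v).const_sub y
      have h2 : HasFDerivAt (fun x' => S (x', y)) (partialOne S (y - t • v) y) (y - t • v) :=
        DifferentiableAt.hasFDerivAt (by have := hS.differentiable; fun_prop)
      have h3 := h2.comp_hasDerivAt t h1
      rw [map_neg] at h3
      exact h3
    have hmon : MonotoneOn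
        (fun t : ℝ => S (y - t • v, y) + M * ‖v‖ * t - A * ‖v‖ ^ 2 / 2 * t ^ 2)
        (Set.Ici 0) := by
      have hd' : ∀ t : ℝ, HasDerivAt
          (fun t : ℝ => S (y - t • v, y) + M * ‖v‖ * t - A * ‖v‖ ^ 2 / 2 * t ^ 2)
          (-partialOne S (y - t • v) y v + M * ‖v‖ - A * ‖v‖ ^ 2 * t) t := by
        intro t
        have h := ((hd t).add ((hasDerivAt_id t).const_mul (M * ‖v‖))).sub
          ((hasDerivAt_pow 2 t).const_mul (A * ‖v‖ ^ 2 / 2))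
        refine h.congr_deriv ?_
        norm_num
        ring
      refine monotoneOn_of_hasDerivWithinAt_nonneg (convex_Ici 0)
        (fun t _ => (hd' t).continuousAt.continuousWithinAt)
        (fun t _ => (hd' t).hasDerivWithinAt) fun t ht => ?_
      rw [interior_Ici, Set.mem_Ioi] at ht
      have := hmono (y - t • v) v t ht.le
      rw [sub_add_cancel] at this
      linarith
    have h01 := hmon Set.self_mem_Ici (Set.mem_Ici.2 zero_le_one) zero_le_one
    have hyv : y - v = x := by rw [hv]; abel
    simp only [zero_smul, sub_zero, mul_zero, add_zero, one_smul, mul_one, one_pow, hyv,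
      ne_eq, OfNat.ofNat_ne_zero, not_false_eq_true, zero_pow] at h01
    have := hx₀ y
    linarith
  -- The constant comes from completing the square in `A r ^ 2 / 2 - (M + 1) r`.
  refine ⟨(M + 1) ^ 2 / (2 * A) - S (x₀, x₀), fun x y => ?_⟩
  have h1 := hlow x y
  have h2 : (M + 1) * ‖y - x‖ ≤ A * ‖y - x‖ ^ 2 / 2 + (M + 1) ^ 2 / (2 * A) := by
    have h3 : A * ‖y - x‖ ^ 2 / 2 + (M + 1) ^ 2 / (2 * A) - (M + 1) * ‖y - x‖ =
        (A * ‖y - x‖ - (M + 1)) ^ 2 / (2 * A) := by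
      field_simp
      ring
    have h4 : 0 ≤ (A * ‖y - x‖ - (M + 1)) ^ 2 / (2 * A) := by positivity
    linarith
  linarith

/-! Variations of a segment of length `m + 1` with fixed ends. -/

/-- The space of displacements of the `m` interior points of a segment. -/
abbrev Variation (d m : ℕ) := PiLp 2 fun _ : Fin m => Space d

/-- The displacement of the `k`-th point of a segment; it vanishes at the ends. -/
def displacement (d m : ℕ) : ℕ → Variation d m →L[ℝ] Space d
  | 0 => 0
  | k + 1 => if h : k < m then PiLp.proj 2 (fun _ : Fin m => Space d) ⟨k, h⟩ else 0

theorem displacement_zero (m : ℕ) : displacement d m 0 = 0 := rfl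

theorem displacement_succ {m k : ℕ} (h : k < m) (q : Variation d m) :
    displacement d m (k + 1) q = q ⟨k, h⟩ := by
  simp [displacement, h]

theorem displacement_last {m k : ℕ} (h : m < k) : displacement d m k = 0 := by
  cases k with
  | zero => rfl
  | succ k => simp [displacement, Nat.not_lt.2 (Nat.lt_succ_iff.1 h)]

/-- The displacement of a pair of consecutive points of a segment. -/
def pairDisplacement (d m k : ℕ) : Variation d m →L[ℝ] Space d × Space d :=
  (displacement d m k).prod (displacement d m (k + 1))

/-- The action of a segment of a sequence. -/
def action (S : Space d × Space d → ℝ) (n : ℕ) (X : ℕ → Space d) : ℝ :=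
  ∑ k ∈ Finset.range n, S (X k, X (k + 1))

/-- The sequence `X` with its first interior points displaced. -/
def displace (X : ℕ → Space d) {m : ℕ} (q : Variation d m) (k : ℕ) : Space d :=
  X k + displacement d m k q

/-- The Hessian of the action of a segment with fixed ends. -/
def hessian (S : Space d × Space d → ℝ) (m : ℕ) (X : ℕ → Space d) :
    Variation d m →L[ℝ] Variation d m →L[ℝ] ℝ :=
  ∑ k ∈ Finset.range (m + 1),
    (fderiv ℝ (fderiv ℝ S) (X k, X (k + 1))).bilinearComp
      (pairDisplacement d m k) (pairDisplacement d m k)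

theorem hessian_apply (m : ℕ) (X : ℕ → Space d) (u v : Variation d m) :
    hessian S m X u v = ∑ k ∈ Finset.range (m + 1),
      fderiv ℝ (fderiv ℝ S) (X k, X (k + 1)) (pairDisplacement d m k u)
        (pairDisplacement d m k v) := by
  simp [hessian, sum_apply]

/-- Extremality of a finite segment `X 0, …, X (m + 1)`. -/
def IsExtremalSegment (S : Space d × Space d → ℝ) (m : ℕ) (X : ℕ → Space d) : Prop :=
  ∀ k < m, partialTwo S (X k) (X (k + 1)) + partialOne S (X (k + 1)) (X (k + 2)) = 0

/-- The point of index `k + 1`, displaced by `v k`, ends pair `k` and starts pair `k + 1`; the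
boundary terms vanish because the ends are fixed. -/
theorem sum_pairDisplacement (m : ℕ) (T : ℕ → (Space d × Space d) →L[ℝ] ℝ) (v : Variation d m) :
    ∑ k ∈ Finset.range (m + 1), T k (pairDisplacement d m k v) =
      ∑ k : Fin m, ((T k).comp (ContinuousLinearMap.inr ℝ _ _) +
        (T (k + 1)).comp (ContinuousLinearMap.inl ℝ _ _)) (v k) := by
  have h1 : ∀ k, T k (pairDisplacement d m k v) =
      (T k).comp (ContinuousLinearMap.inl ℝ _ _) (displacement d m k v) +
      (T k).comp (ContinuousLinearMap.inr ℝ _ _) (displacement d m (k + 1) v) := fun k => by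
    simp [pairDisplacement, ← map_add]
  simp only [h1, Finset.sum_add_distrib]
  rw [Finset.sum_range_succ', Finset.sum_range_succ, displacement_zero,
    displacement_last (Nat.lt_succ_self m), zero_apply, map_zero, map_zero, add_zero, add_zero,
    ← Finset.sum_add_distrib, ← Fin.sum_univ_eq_sum_range (fun k =>
      (T (k + 1)).comp (ContinuousLinearMap.inl ℝ _ _) (displacement d m (k + 1) v) +
      (T k).comp (ContinuousLinearMap.inr ℝ _ _) (displacement d m (k + 1) v))]
  refine Finset.sum_congr rfl fun k _ => ?_
  rw [displacement_succ k.2, add_comm]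
  rfl

/-- Summation by parts: a sum over consecutive pairs vanishes for all variations if and only if
the total coefficients of the interior points do. -/
theorem forall_sum_pairDisplacement_eq_zero_iff (m : ℕ) (T : ℕ → (Space d × Space d) →L[ℝ] ℝ) :
    (∀ v, ∑ k ∈ Finset.range (m + 1), T k (pairDisplacement d m k v) = 0) ↔
      ∀ k < m, (T k).comp (ContinuousLinearMap.inr ℝ _ _) +
        (T (k + 1)).comp (ContinuousLinearMap.inl ℝ _ _) = 0 := by
  simp only [sum_pairDisplacement]
  constructor
  · intro h k hk
    ext ξ
    have := h (WithLp.toLp 2 (Pi.single (⟨k, hk⟩ : Fin m) ξ))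
    rw [Finset.sum_eq_single (⟨k, hk⟩ : Fin m)] at this
    · simpa using this
    · intro j _ hj
      rw [show (WithLp.toLp 2 (Pi.single (⟨k, hk⟩ : Fin m) ξ) : Variation d m) j = 0 by simp [hj],
        map_zero]
    · simp
  · intro h v
    exact Finset.sum_eq_zero fun k _ => by rw [h k k.2, zero_apply]

/-! ### Derivatives of sums of `S` composed with affine maps -/

section SumComp

variable {E : Type*} [NormedAddCommGroup E] [NormedSpace ℝ E]
  (p : ℕ → Space d × Space d) (J : ℕ → E →L[ℝ] Space d × Space d) (n : ℕ)

theorem hasFDerivAt_sum_comp (hS : IsGeneratingFunction S) (q : E) :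
    HasFDerivAt (fun q => ∑ k ∈ Finset.range n, S (p k + J k q))
      (∑ k ∈ Finset.range n, (fderiv ℝ S (p k + J k q)).comp (J k)) q :=
  HasFDerivAt.fun_sum fun k _ => (hS.differentiable _).hasFDerivAt.comp q
    ((J k).hasFDerivAt.const_add (p k))

theorem fderiv_sum_comp_eq_zero_iff (hS : IsGeneratingFunction S) (q : E) :
    fderiv ℝ (fun q => ∑ k ∈ Finset.range n, S (p k + J k q)) q = 0 ↔
      ∀ v, ∑ k ∈ Finset.range n, fderiv ℝ S (p k + J k q) (J k v) = 0 := by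
  rw [(hasFDerivAt_sum_comp p J n hS q).fderiv, ContinuousLinearMap.ext_iff]
  simp [sum_apply]

theorem contDiff_sum_comp (hS : IsGeneratingFunction S) :
    ContDiff ℝ 2 fun q => ∑ k ∈ Finset.range n, S (p k + J k q) :=
  ContDiff.sum fun k _ => hS.contDiff.comp (contDiff_const.add (J k).contDiff)

theorem fderiv_fderiv_sum_comp (hS : IsGeneratingFunction S) (q : E) :
    fderiv ℝ (fderiv ℝ fun q => ∑ k ∈ Finset.range n, S (p k + J k q)) q =
      ∑ k ∈ Finset.range n,
        (fderiv ℝ (fderiv ℝ S) (p k + J k q)).bilinearComp (J k) (J k) := by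
  have h1 : (fderiv ℝ fun q => ∑ k ∈ Finset.range n, S (p k + J k q)) = fun q =>
      ∑ k ∈ Finset.range n, (fderiv ℝ S (p k + J k q)).comp (J k) :=
    funext fun q => (hasFDerivAt_sum_comp p J n hS q).fderiv
  have h2 : ∀ k, HasFDerivAt (fun q => fderiv ℝ S (p k + J k q))
      ((fderiv ℝ (fderiv ℝ S) (p k + J k q)).comp (J k)) q := fun k =>
    (hS.contDiff_fderiv.differentiable one_ne_zero _).hasFDerivAt.comp q
      ((J k).hasFDerivAt.const_add (p k))
  rw [h1, (HasFDerivAt.fun_sum fun k _ =>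
    (h2 k).clm_comp (hasFDerivAt_const (J k) q)).fderiv]
  ext u v
  simp [sum_apply]

end SumComp

theorem contDiff_action_displace (hS : IsGeneratingFunction S) (m : ℕ) (X : ℕ → Space d) :
    ContDiff ℝ 2 fun q : Variation d m => action S (m + 1) (displace X q) :=
  contDiff_sum_comp (fun k => (X k, X (k + 1))) (pairDisplacement d m) (m + 1) hS

/-- Summation by parts yields the discrete Euler–Lagrange equations at the interior points. -/
theorem fderiv_action_displace_eq_zero_iff (hS : IsGeneratingFunction S) (m : ℕ)
    (X : ℕ → Space d) (q : Variation d m) :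
    fderiv ℝ (fun q : Variation d m => action S (m + 1) (displace X q)) q = 0 ↔
      IsExtremalSegment S m (displace X q) := by
  refine (fderiv_sum_comp_eq_zero_iff (fun k => (X k, X (k + 1))) (pairDisplacement d m)
    (m + 1) hS q).trans ?_
  refine (forall_sum_pairDisplacement_eq_zero_iff m
    fun k => fderiv ℝ S ((X k, X (k + 1)) + pairDisplacement d m k q)).trans ?_
  simp only [IsExtremalSegment, partialOne_eq hS, partialTwo_eq hS]
  rfl

theorem fderiv_fderiv_action_displace (hS : IsGeneratingFunction S) (m : ℕ)
    (X : ℕ → Space d) (q : Variation d m) :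
    fderiv ℝ (fderiv ℝ fun q : Variation d m => action S (m + 1) (displace X q)) q =
      hessian S m (displace X q) :=
  fderiv_fderiv_sum_comp (fun k => (X k, X (k + 1))) (pairDisplacement d m) (m + 1) hS q

theorem hessian_symm (hS : IsGeneratingFunction S) (m : ℕ) (X : ℕ → Space d)
    (u v : Variation d m) : hessian S m X u v = hessian S m X v u := by
  simp only [hessian_apply]
  refine Finset.sum_congr rfl fun k _ => ?_
  exact (hS.contDiff.contDiffAt.isSymmSndFDerivAt (by simp) :
    IsSymmSndFDerivAt ℝ S (X k, X (k + 1))) _ _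

theorem norm_displace_sub_le {C : ℝ} (hC : ∀ x y, ‖y - x‖ ≤ S (x, y) + C) {n : ℕ}
    (X : ℕ → Space d) {k : ℕ} (hk : k ≤ n) : ‖X k - X 0‖ ≤ action S n X + n * C := by
  calc ‖X k - X 0‖ = ‖∑ j ∈ Finset.range k, (X (j + 1) - X j)‖ := by
        rw [Finset.sum_range_sub]
    _ ≤ ∑ j ∈ Finset.range k, ‖X (j + 1) - X j‖ := norm_sum_le _ _
    _ ≤ ∑ j ∈ Finset.range n, ‖X (j + 1) - X j‖ :=
        Finset.sum_le_sum_of_subset_of_nonneg (Finset.range_mono hk) fun _ _ _ => norm_nonneg _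
    _ ≤ ∑ j ∈ Finset.range n, (S (X j, X (j + 1)) + C) := Finset.sum_le_sum fun j _ => hC _ _
    _ = action S n X + n * C := by simp [action, Finset.sum_add_distrib]

theorem tendsto_action_displace (hS : IsGeneratingFunction S) (m : ℕ) (X : ℕ → Space d) :
    Tendsto (fun q : Variation d m => action S (m + 1) (displace X q)) (cocompact _) atTop := by
  obtain ⟨C, hC⟩ := exists_norm_sub_le hS
  rw [← Metric.cobounded_eq_cocompact]
  have hbound : ∀ q : Variation d m, ‖q‖ + -(∑ k : Fin m, ‖X 0 - X (k + 1)‖ +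
      m * ((m + 1 : ℕ) * C)) ≤ m * action S (m + 1) (displace X q) := by
    intro q
    have h1 : ‖q‖ ≤ ∑ k : Fin m, ‖q k‖ := by
      have : q = ∑ k : Fin m, WithLp.toLp 2 (Pi.single k (q k)) := by
        ext1 j
        simp [Finset.sum_apply, Finset.sum_pi_single]
      calc ‖q‖ = ‖∑ k : Fin m, (WithLp.toLp 2 (Pi.single k (q k)) : Variation d m)‖ := by
            rw [← this]
        _ ≤ ∑ k : Fin m, ‖(WithLp.toLp 2 (Pi.single k (q k)) : Variation d m)‖ :=
            norm_sum_le _ _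
        _ = ∑ k : Fin m, ‖q k‖ := by simp
    have h2 : ∀ k : Fin m, ‖q k‖ ≤
        ‖X 0 - X (k + 1)‖ + (action S (m + 1) (displace X q) + (m + 1 : ℕ) * C) := by
      intro k
      have h3 := norm_displace_sub_le hC (displace X q) (n := m + 1) (k := k + 1) (by omega)
      have h4 : q k = (X 0 - X (k + 1)) + (displace X q (k + 1) - displace X q 0) := by
        simp only [displace, displacement_succ k.2, displacement_zero, zero_apply]
        abel
      rw [h4]
      exact (norm_add_le _ _).trans (by linarith)
    have h5 := h1.trans (Finset.sum_le_sum fun k _ => h2 k)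
    simp only [Finset.sum_add_distrib, Finset.sum_const, Finset.card_univ, Fintype.card_fin,
      nsmul_eq_mul] at h5
    linarith
  -- Without interior points the bound is void, but the space of variations is a single point.
  rcases Nat.eq_zero_or_pos m with rfl | hm
  · have : Bornology.cobounded (Variation d 0) = ⊥ :=
      Bornology.cobounded_eq_bot_iff.2 ⟨(Set.toFinite _).isBounded⟩
    rw [this]
    exact tendsto_bot
  · have := tendsto_atTop_mono hbound
      (tendsto_atTop_add_const_right _ _ tendsto_norm_cobounded_atTop)
    exact (tendsto_const_mul_atTop_of_pos (by exact_mod_cast hm)).1 this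

theorem exists_minimizing_displacement (hS : IsGeneratingFunction S) (m : ℕ) (X : ℕ → Space d) :
    ∃ q : Variation d m, ∀ q' : Variation d m,
      action S (m + 1) (displace X q) ≤ action S (m + 1) (displace X q') :=
  (contDiff_action_displace hS m X).continuous.exists_forall_le (tendsto_action_displace hS m X)

end Action

/-! ### Orbits, Jacobi fields and uniqueness of extremal segments -/

section Dynamics

open Filter

variable {d : ℕ} {S : Space d × Space d → ℝ}

/-- The chart `(x, x') ↦ (x, -∂₁S(x, x'))` of `T^*ℝ^d`. -/
def initialCovector (S : Space d × Space d → ℝ) (w : Space d × Space d) : Cotangent d :=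
  (w.1, -(fderiv ℝ S w).comp (ContinuousLinearMap.inl ℝ (Space d) (Space d)))

/-- The chart `(x, x') ↦ (x', ∂₂S(x, x'))` of `T^*ℝ^d`. -/
def finalCovector (S : Space d × Space d → ℝ) (w : Space d × Space d) : Cotangent d :=
  (w.2, (fderiv ℝ S w).comp (ContinuousLinearMap.inr ℝ (Space d) (Space d)))

/-- In the coordinates `(x, x')` the twist map is explicit; this gives access to its differential.
-/
theorem lift_initialCovector (hS : IsGeneratingFunction S) (w : Space d × Space d) :
    lift hS (initialCovector S w) = finalCovector S w := by
  obtain ⟨x, x'⟩ := w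
  rw [initialCovector, finalCovector, lift_eq_iff, partialOne_eq hS, partialTwo_eq hS]
  exact ⟨rfl, rfl⟩

theorem initialCovector_lift (hS : IsGeneratingFunction S) (z : Cotangent d) :
    initialCovector S (z.1, (lift hS z).1) = z := by
  obtain ⟨x, p⟩ := z
  have h := (lift_eq_iff hS x (lift hS (x, p)).1 p (lift hS (x, p)).2).1 rfl
  refine Prod.ext rfl ?_
  rw [partialOne_eq hS] at h
  exact h.1.symm

theorem mixed_apply' (hS : IsGeneratingFunction S) (x y η ξ : Space d) :
    mixed S x y η ξ = fderiv ℝ (fderiv ℝ S) (x, y) (ξ, 0) (0, η) :=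
  (mixed_apply hS x y η ξ).trans ((hS.contDiff.contDiffAt.isSymmSndFDerivAt (by simp) :
    IsSymmSndFDerivAt ℝ S (x, y)) _ _)

theorem eq_zero_of_mixed_self_eq_zero (hS : IsGeneratingFunction S) {x y ξ : Space d}
    (h : mixed S x y ξ ξ = 0) : ξ = 0 := by
  obtain ⟨A, hA, htw⟩ := hS.twist
  have h1 := htw x y ξ
  rw [h] at h1
  by_contra hne
  have := norm_pos_iff.2 hne
  nlinarith [mul_pos hA (pow_pos this 2)]

/-- The differential of `initialCovector`. -/
def initialCovectorDeriv (S : Space d × Space d → ℝ) (w : Space d × Space d) :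
    Space d × Space d →L[ℝ] Cotangent d :=
  (ContinuousLinearMap.fst ℝ _ _).prod
    (-((ContinuousLinearMap.compL ℝ (Space d) (Space d × Space d) ℝ).flip
      (ContinuousLinearMap.inl ℝ (Space d) (Space d))).comp (fderiv ℝ (fderiv ℝ S) w))

theorem initialCovectorDeriv_apply (w v : Space d × Space d) : initialCovectorDeriv S w v =
    (v.1, -(fderiv ℝ (fderiv ℝ S) w v).comp (ContinuousLinearMap.inl ℝ (Space d) (Space d))) :=
  rfl

/-- The differential of `finalCovector`. -/
def finalCovectorDeriv (S : Space d × Space d → ℝ) (w : Space d × Space d) :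
    Space d × Space d →L[ℝ] Cotangent d :=
  (ContinuousLinearMap.snd ℝ _ _).prod
    (((ContinuousLinearMap.compL ℝ (Space d) (Space d × Space d) ℝ).flip
      (ContinuousLinearMap.inr ℝ (Space d) (Space d))).comp (fderiv ℝ (fderiv ℝ S) w))

theorem finalCovectorDeriv_apply (w v : Space d × Space d) : finalCovectorDeriv S w v =
    (v.2, (fderiv ℝ (fderiv ℝ S) w v).comp (ContinuousLinearMap.inr ℝ (Space d) (Space d))) :=
  rfl

theorem hasStrictFDerivAt_initialCovector (hS : IsGeneratingFunction S) (w : Space d × Space d) :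
    HasStrictFDerivAt (initialCovector S) (initialCovectorDeriv S w) w := by
  have h := hS.contDiff_fderiv.contDiffAt.hasStrictFDerivAt (x := w) one_ne_zero
  exact (hasStrictFDerivAt_fst).prodMk ((((ContinuousLinearMap.compL ℝ (Space d) (Space d × Space d) ℝ).flip
      (ContinuousLinearMap.inl ℝ (Space d) (Space d))).hasStrictFDerivAt.comp w h).neg)

theorem hasStrictFDerivAt_finalCovector (hS : IsGeneratingFunction S) (w : Space d × Space d) :
    HasStrictFDerivAt (finalCovector S) (finalCovectorDeriv S w) w := by
  have h := hS.contDiff_fderiv.contDiffAt.hasStrictFDerivAt (x := w) one_ne_zero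
  exact (hasStrictFDerivAt_snd).prodMk (((ContinuousLinearMap.compL ℝ (Space d) (Space d × Space d) ℝ).flip
      (ContinuousLinearMap.inr ℝ (Space d) (Space d))).hasStrictFDerivAt.comp w h)

theorem initialCovectorDeriv_injective (hS : IsGeneratingFunction S) (w : Space d × Space d) :
    Function.Injective (initialCovectorDeriv S w) := by
  refine (injective_iff_map_eq_zero _).2 fun v hv => ?_
  rw [initialCovectorDeriv_apply, Prod.mk_eq_zero, neg_eq_zero] at hv
  obtain ⟨v₁, v₂⟩ := v
  obtain rfl : v₁ = 0 := hv.1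
  have h2 := DFunLike.congr_fun hv.2 v₂
  have h3 : mixed S w.1 w.2 v₂ v₂ = 0 := by
    rw [mixed_apply hS]
    exact h2
  rw [eq_zero_of_mixed_self_eq_zero hS h3]
  rfl

/-- The twist condition makes the differential of `initialCovector` invertible, so `lift` is locally
`finalCovector` composed with an inverse given by the inverse function theorem. -/
theorem differentiable_lift (hS : IsGeneratingFunction S) : Differentiable ℝ (lift hS) := by
  intro z
  set w := (z.1, (lift hS z).1)
  have hz : initialCovector S w = z := initialCovector_lift hS z
  have hfin : Module.finrank ℝ (Space d × Space d) = Module.finrank ℝ (Cotangent d) := by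
    rw [Module.finrank_prod, Module.finrank_prod,
      (InnerProductSpace.toDual ℝ (Space d)).toLinearEquiv.finrank_eq]
  let e : (Space d × Space d) ≃L[ℝ] Cotangent d :=
    (LinearMap.linearEquivOfInjective (initialCovectorDeriv S w : _ →ₗ[ℝ] Cotangent d)
      (initialCovectorDeriv_injective hS w) hfin).toContinuousLinearEquiv
  have he : (e : (Space d × Space d) →L[ℝ] Cotangent d) = initialCovectorDeriv S w :=
    ContinuousLinearMap.ext fun v => rfl
  have hs : HasStrictFDerivAt (initialCovector S) (e : (Space d × Space d) →L[ℝ] Cotangent d) w :=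
    he ▸ hasStrictFDerivAt_initialCovector hS w
  have h1 := hs.to_localInverse.hasFDerivAt
  have h2 : DifferentiableAt ℝ (finalCovector S)
      (hs.localInverse (initialCovector S) e w (initialCovector S w)) :=
    (hasStrictFDerivAt_finalCovector hS _).hasFDerivAt.differentiableAt
  have h3 : DifferentiableAt ℝ
      (finalCovector S ∘ hs.localInverse (initialCovector S) e w) (initialCovector S w) :=
    h2.comp _ h1.differentiableAt
  rw [← hz]
  refine h3.congr_of_eventuallyEq ?_
  filter_upwards [hs.eventually_right_inverse] with y hy
  rw [Function.comp_apply, ← lift_initialCovector hS, hy]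

theorem fderiv_lift_initialCovectorDeriv (hS : IsGeneratingFunction S) (w v : Space d × Space d) :
    fderiv ℝ (lift hS) (initialCovector S w) (initialCovectorDeriv S w v) =
      finalCovectorDeriv S w v := by
  have h1 := (differentiable_lift hS (initialCovector S w)).hasFDerivAt.comp w
    (hasStrictFDerivAt_initialCovector hS w).hasFDerivAt
  have h2 : lift hS ∘ initialCovector S = finalCovector S :=
    funext fun w => lift_initialCovector hS w
  rw [h2] at h1
  exact DFunLike.congr_fun (h1.unique (hasStrictFDerivAt_finalCovector hS w).hasFDerivAt) v

/-- The base points of the forward orbit of `z`. -/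
def orbit (hS : IsGeneratingFunction S) (z : Cotangent d) (k : ℕ) : Space d :=
  ((lift hS)^[k] z).1

theorem iterate_lift_eq (hS : IsGeneratingFunction S) (z : Cotangent d) (k : ℕ) :
    (lift hS)^[k] z = initialCovector S (orbit hS z k, orbit hS z (k + 1)) := by
  conv_lhs => rw [← initialCovector_lift hS ((lift hS)^[k] z)]
  rw [orbit, orbit, Function.iterate_succ_apply']

theorem continuous_orbit (hS : IsGeneratingFunction S) (k : ℕ) :
    Continuous fun z => orbit hS z k :=
  continuous_fst.comp ((differentiable_lift hS).iterate k).continuous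

/-- Extremal segments are projections of orbits of the twist map. -/
theorem exists_orbit_eq (hS : IsGeneratingFunction S) {m : ℕ} {X : ℕ → Space d}
    (hX : IsExtremalSegment S m X) : ∃ z, ∀ k ≤ m + 1, orbit hS z k = X k := by
  refine ⟨initialCovector S (X 0, X 1), ?_⟩
  have h : ∀ k ≤ m, (lift hS)^[k] (initialCovector S (X 0, X 1)) =
      initialCovector S (X k, X (k + 1)) := by
    intro k
    induction k with
    | zero => exact fun _ => rfl
    | succ k ih =>
      intro hk
      rw [Function.iterate_succ_apply', ih (by omega), lift_initialCovector]
      -- Extremality says that the final covector of one pair is the initial covector of the next.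
      have := hX k (by omega)
      rw [partialOne_eq hS, partialTwo_eq hS] at this
      exact Prod.ext rfl (eq_neg_of_add_eq_zero_left this)
  intro k hk
  rcases Nat.lt_or_ge m k with hmk | hkm
  · obtain rfl : k = m + 1 := by omega
    rw [orbit, Function.iterate_succ_apply', h m le_rfl, lift_initialCovector]
    rfl
  · rw [orbit, h k hkm]
    rfl

theorem proj_iterate_lift (hS : IsGeneratingFunction S) (n : ℕ) (z : Cotangent d) :
    proj ((lift hS)^[n] z) = (twistMap hS ^ n) (proj z) := by
  induction n with
  | zero => rfl
  | succ n ih =>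
    rw [Function.iterate_succ_apply', pow_succ', Equiv.Perm.mul_apply, ← ih]
    rfl

/-- Without conjugate points, no nonzero vertical vector is mapped to a vertical vector. -/
theorem NoConjugatePoints.snd_eq_zero {hS : IsGeneratingFunction S} (hF : NoConjugatePoints hS)
    (m : ℕ) (z : Cotangent d) (η η' : Dual d)
    (h : fderiv ℝ (lift hS)^[m + 1] z (0, η) = (0, η')) : η' = 0 := by
  have hL := hF (proj z) (m + 1 : ℕ) (by exact_mod_cast Nat.succ_ne_zero m)
    (fderiv ℝ (lift hS)^[m + 1] z) ⟨(lift hS)^[m + 1], z, rfl, Eventually.of_forall fun w => by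
      rw [proj_iterate_lift, zpow_natCast],
      ((differentiable_lift hS).iterate (m + 1) z).hasFDerivAt⟩
  have hmem : ((0, η') : Cotangent d) ∈ vertical d ⊓ (vertical d).map
      (fderiv ℝ (lift hS)^[m + 1] z : Cotangent d →ₗ[ℝ] Cotangent d) :=
    ⟨rfl, (0, η), rfl, h⟩
  rw [hL, Submodule.mem_bot] at hmem
  exact (Prod.mk_eq_zero.1 hmem).2

/-- Without conjugate points, extremal segments have a nondegenerate Hessian. -/
theorem hessian_orbit_nondegenerate {hS : IsGeneratingFunction S} (hF : NoConjugatePoints hS)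
    (m : ℕ) (z : Cotangent d) (u : Variation d m)
    (hu : ∀ v, hessian S m (orbit hS z) u v = 0) : u = 0 := by
  set w : ℕ → Space d × Space d := fun k => (orbit hS z k, orbit hS z (k + 1)) with hw
  set T : ℕ → (Space d × Space d) →L[ℝ] ℝ := fun k =>
    fderiv ℝ (fderiv ℝ S) (w k) (pairDisplacement d m k u) with hT
  -- The Jacobi equation: `u` solves the linearized extremality condition, so the differentials of
  -- the iterates transport its consecutive pairs.
  have hjac := (forall_sum_pairDisplacement_eq_zero_iff m T).1 fun v => by
    rw [← hu v, hessian_apply]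
  have hderiv : ∀ k ≤ m, fderiv ℝ (lift hS)^[k] z
      (initialCovectorDeriv S (w 0) (pairDisplacement d m 0 u)) =
      initialCovectorDeriv S (w k) (pairDisplacement d m k u) := by
    intro k
    induction k with
    | zero => intro _; simp
    | succ k ih =>
      intro hk
      rw [Function.iterate_succ', fderiv_comp z (differentiable_lift hS _)
        ((differentiable_lift hS).iterate k z), ContinuousLinearMap.comp_apply, ih (by omega),
        iterate_lift_eq, fderiv_lift_initialCovectorDeriv]
      exact Prod.ext rfl (eq_neg_of_add_eq_zero_left (hjac k (by omega)))
  have hlast : fderiv ℝ (lift hS)^[m + 1] z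
      (0, -(T 0).comp (ContinuousLinearMap.inl ℝ (Space d) (Space d))) =
      (0, (T m).comp (ContinuousLinearMap.inr ℝ (Space d) (Space d))) := by
    have h := hderiv m le_rfl
    have h0 : initialCovectorDeriv S (w 0) (pairDisplacement d m 0 u) =
      (0, -(T 0).comp (ContinuousLinearMap.inl ℝ (Space d) (Space d))) := rfl
    rw [← h0, Function.iterate_succ', fderiv_comp z (differentiable_lift hS _)
        ((differentiable_lift hS).iterate m z), ContinuousLinearMap.comp_apply, h,
        iterate_lift_eq, fderiv_lift_initialCovectorDeriv, finalCovectorDeriv_apply]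
    refine Prod.ext ?_ rfl
    show displacement d m (m + 1) u = 0
    rw [displacement_last (Nat.lt_succ_self m), zero_apply]
  -- Descent from the last point, where the transported vertical vector is zero: a pair `(ξ, 0)`
  -- with zero final covector has `ξ = 0` by the twist condition, and the Jacobi equation passes
  -- this to the preceding pair.
  have hback : ∀ j k, k + j = m → displacement d m (k + 1) u = 0 ∧
      (T k).comp (ContinuousLinearMap.inr ℝ (Space d) (Space d)) = 0 := by
    intro j
    induction j with
    | zero =>
      rintro k rfl
      refine ⟨?_, hF.snd_eq_zero _ _ _ _ hlast⟩
      rw [displacement_last (Nat.lt_succ_self _), zero_apply]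
    | succ j ih =>
      intro k hk
      obtain ⟨h1, h2⟩ := ih (k + 1) (by omega)
      have h3 : pairDisplacement d m (k + 1) u = (displacement d m (k + 1) u, 0) :=
        Prod.ext rfl h1
      have h4 := DFunLike.congr_fun h2 (displacement d m (k + 1) u)
      have h5 : mixed S (w (k + 1)).1 (w (k + 1)).2 (displacement d m (k + 1) u)
          (displacement d m (k + 1) u) = 0 := by
        rw [mixed_apply' hS, ← h3]
        exact h4
      have h6 := eq_zero_of_mixed_self_eq_zero hS h5
      refine ⟨h6, ?_⟩
      have h7 := hjac k (by omega)
      have h8 : T (k + 1) = 0 := by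
        simp only [hT]
        rw [h3, h6, ← Prod.zero_eq_mk, map_zero]
      rwa [h8, ContinuousLinearMap.zero_comp, add_zero] at h7
  ext1 k
  have := (hback (m - k) k (by omega)).1
  rwa [displacement_succ k.2] at this

theorem hessian_congr {m : ℕ} {X Y : ℕ → Space d} (h : ∀ k ≤ m + 1, X k = Y k) :
    hessian S m X = hessian S m Y :=
  Finset.sum_congr rfl fun k hk => by
    rw [Finset.mem_range] at hk
    rw [h k (by omega), h (k + 1) (by omega)]

theorem continuous_hessian_orbit (hS : IsGeneratingFunction S) (m : ℕ) :
    Continuous fun p : Cotangent d × Variation d m => hessian S m (orbit hS p.1) p.2 p.2 := by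
  simp only [hessian_apply]
  refine continuous_finsetSum _ fun k _ => ?_
  have h1 : Continuous (fderiv ℝ (fderiv ℝ S)) := hS.contDiff_fderiv.continuous_fderiv one_ne_zero
  have h2 := (continuous_orbit hS k).comp (continuous_fst (X := Cotangent d) (Y := Variation d m))
  have h3 := (continuous_orbit hS (k + 1)).comp
    (continuous_fst (X := Cotangent d) (Y := Variation d m))
  have h4 := (pairDisplacement d m k).continuous.comp
    (continuous_snd (X := Cotangent d) (Y := Variation d m))
  exact ((h1.comp (h2.prodMk h3)).clm_apply h4).clm_apply h4

/-- Without conjugate points, extremal segments have a positive definite Hessian. -/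
theorem hessian_orbit_pos {hS : IsGeneratingFunction S} (hF : NoConjugatePoints hS)
    (m : ℕ) (z : Cotangent d) {u : Variation d m} (hu : u ≠ 0) :
    0 < hessian S m (orbit hS z) u u := by
  -- One semidefinite Hessian starts the connectedness argument; a minimizing segment from `0` to
  -- `0` provides it.
  obtain ⟨z₀, hz₀⟩ : ∃ z, ∀ u, 0 ≤ hessian S m (orbit hS z) u u := by
    obtain ⟨q, hq⟩ := exists_minimizing_displacement hS m fun _ => 0
    have hcrit : fderiv ℝ (fun q : Variation d m => action S (m + 1) (displace (fun _ => 0) q)) q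
        = 0 := IsLocalMin.fderiv_eq_zero (Eventually.of_forall hq)
    obtain ⟨z, hz⟩ := exists_orbit_eq hS ((fderiv_action_displace_eq_zero_iff hS m _ q).1 hcrit)
    refine ⟨z, fun u => ?_⟩
    rw [hessian_congr hz, ← fderiv_fderiv_action_displace hS]
    exact secondDeriv_nonneg_of_forall_le (contDiff_action_displace hS m _) hq u
  exact pos_of_preconnectedSpace (fun z => hessian S m (orbit hS z))
    (continuous_hessian_orbit hS m) (fun z => hessian_symm hS m _)
    (hessian_orbit_nondegenerate hF m) hz₀ z hu

theorem displace_zero (X : ℕ → Space d) (m : ℕ) : displace X (0 : Variation d m) = X := by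
  funext k
  simp [displace]

theorem exists_displace_eq {m : ℕ} {X Y : ℕ → Space d} (h0 : X 0 = Y 0)
    (h1 : X (m + 1) = Y (m + 1)) :
    ∃ q : Variation d m, ∀ k ≤ m + 1, displace X q k = Y k := by
  refine ⟨WithLp.toLp 2 fun k => Y (k + 1) - X (k + 1), fun k hk => ?_⟩
  cases k with
  | zero => rw [displace, displacement_zero, zero_apply, add_zero, h0]
  | succ k =>
    rcases Nat.lt_or_ge k m with hkm | hkm
    · rw [displace, displacement_succ hkm]
      simp
    · obtain rfl : k = m := by omega
      rw [displace, displacement_last (Nat.lt_succ_self k), zero_apply, add_zero, h1]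

theorem action_congr {n : ℕ} {X Y : ℕ → Space d} (h : ∀ k ≤ n, X k = Y k) :
    action S n X = action S n Y :=
  Finset.sum_congr rfl fun k hk => by
    rw [Finset.mem_range] at hk
    rw [h k (by omega), h (k + 1) (by omega)]

/-- Without conjugate points, there is at most one extremal variation. -/
theorem displacement_unique {hS : IsGeneratingFunction S} (hF : NoConjugatePoints hS) {m : ℕ}
    {X : ℕ → Space d} {q q' : Variation d m} (hq : IsExtremalSegment S m (displace X q))
    (hq' : IsExtremalSegment S m (displace X q')) : q = q' := by
  refine eq_of_fderiv_eq_zero (contDiff_action_displace hS m X) (tendsto_action_displace hS m X)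
    (fun p hp => ?_) ((fderiv_action_displace_eq_zero_iff hS m X q).2 hq)
    ((fderiv_action_displace_eq_zero_iff hS m X q').2 hq')
  refine eventually_lt_of_secondDeriv_pos (contDiff_action_displace hS m X) hp fun v hv => ?_
  obtain ⟨z, hz⟩ := exists_orbit_eq hS ((fderiv_action_displace_eq_zero_iff hS m _ p).1 hp)
  rw [fderiv_fderiv_action_displace hS, ← hessian_congr hz]
  exact hessian_orbit_pos hF m z hv

/-- Without conjugate points, extremal segments are determined by their ends. -/
theorem IsExtremalSegment.eq {hS : IsGeneratingFunction S} (hF : NoConjugatePoints hS) {m : ℕ}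
    {X Y : ℕ → Space d} (hX : IsExtremalSegment S m X) (hY : IsExtremalSegment S m Y)
    (h0 : X 0 = Y 0) (h1 : X (m + 1) = Y (m + 1)) : ∀ k ≤ m + 1, X k = Y k := by
  obtain ⟨q, hq⟩ := exists_displace_eq h0 h1
  have hq' : IsExtremalSegment S m (displace X q) := fun k hk => by
    rw [hq k (by omega), hq (k + 1) (by omega), hq (k + 2) (by omega)]
    exact hY k hk
  have h := displacement_unique hF (X := X) (q := 0) (by rwa [displace_zero]) hq'
  intro k hk
  rw [← hq k hk, ← h, displace_zero]

/-- Without conjugate points, extremal segments are minimizing. -/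
theorem IsExtremalSegment.action_le {hS : IsGeneratingFunction S} (hF : NoConjugatePoints hS)
    {m : ℕ} {X Y : ℕ → Space d} (hX : IsExtremalSegment S m X)
    (h0 : X 0 = Y 0) (h1 : X (m + 1) = Y (m + 1)) : action S (m + 1) X ≤ action S (m + 1) Y := by
  -- The minimizer is critical, and uniqueness identifies it with `X`.
  obtain ⟨p, hp⟩ := exists_minimizing_displacement hS m X
  have hcrit : fderiv ℝ (fun q : Variation d m => action S (m + 1) (displace X q)) p = 0 :=
    IsLocalMin.fderiv_eq_zero (Eventually.of_forall hp)
  have h := displacement_unique hF (X := X) (q := 0) (by rwa [displace_zero])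
    ((fderiv_action_displace_eq_zero_iff hS m X p).1 hcrit)
  obtain ⟨q, hq⟩ := exists_displace_eq h0 h1
  rw [← action_congr hq]
  have := hp q
  rwa [← h, displace_zero] at this

end Dynamics

/-! ### The three conclusions -/

section Main

variable {d : ℕ} {S : Space d × Space d → ℝ}

theorem IsExtremal.isExtremalSegment {x : ℤ → Space d} (hx : IsExtremal S x) (i : ℤ) (m : ℕ) :
    IsExtremalSegment S m fun k => x (i + k) := by
  intro k _
  have h := hx (i + k + 1)
  rw [add_sub_cancel_right] at h
  simpa [add_assoc, one_add_one_eq_two] using h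

theorem shift_apply (hS : IsGeneratingFunction S) (r : Fin d → ℤ) (x y : Space d) (k : ℕ) :
    S (x + k • intVec d r, y + k • intVec d r) = S (x, y) := by
  rw [← map_nsmul]
  exact hS.periodic _ _ _

/-- Differentiation along `(v, v)`. For `s` in `ℤ^d`, periodicity turns this into extremality of the
progression `x + k s`. -/
theorem partialOne_add_partialTwo_eq_zero_of_isLocalExtr (hS : IsGeneratingFunction S)
    {s x : Space d} (h : IsLocalExtr (fun x => S (x, x + s)) x) :
    partialTwo S x (x + s) + partialOne S x (x + s) = 0 := by
  have h1 : HasFDerivAt (fun x => S (x, x + s)) ((fderiv ℝ S (x, x + s)).comp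
      ((ContinuousLinearMap.id ℝ (Space d)).prod (ContinuousLinearMap.id ℝ (Space d)))) x :=
    HasFDerivAt.comp (f := fun x => (x, x + s)) x (hS.differentiable (x, x + s)).hasFDerivAt
      ((hasFDerivAt_id x).prodMk ((hasFDerivAt_id x).add_const s))
  have h2 := h.hasFDerivAt_eq_zero h1
  rw [partialOne_eq hS, partialTwo_eq hS]
  ext v
  have h3 := DFunLike.congr_fun h2 v
  simp only [ContinuousLinearMap.comp_apply, ContinuousLinearMap.prod_apply,
    ContinuousLinearMap.id_apply, zero_apply] at h3
  simp only [add_apply, ContinuousLinearMap.comp_apply, ContinuousLinearMap.inl_apply,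
    ContinuousLinearMap.inr_apply, zero_apply, ← map_add, Prod.mk_add_mk, zero_add, add_zero, h3]

/-- Without conjugate points, `S (x, x + r)` does not depend on `x`. -/
theorem NoConjugatePoints.apply_add_intVec_eq {hS : IsGeneratingFunction S}
    (hF : NoConjugatePoints hS) (r : Fin d → ℤ) (x y : Space d) :
    S (x, x + intVec d r) = S (y, y + intVec d r) := by
  set s := intVec d r with hs
  have hcont : Continuous fun x => S (x, x + s) := by
    have := hS.contDiff.continuous
    fun_prop
  have hper : ∀ (k : Fin d → ℤ) (x : Space d),
      S (x + intVec d k, x + intVec d k + s) = S (x, x + s) := fun k x => by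
    rw [add_right_comm, hS.periodic]
  obtain ⟨a, ha⟩ := exists_forall_le_of_periodic hcont hper
  obtain ⟨b, hb⟩ := exists_forall_le_of_periodic (f := fun x => -S (x, x + s)) hcont.neg
    fun k x => by rw [hper]
  have hcrit := partialOne_add_partialTwo_eq_zero_of_isLocalExtr hS (s := s) (x := a)
    (Or.inr (Filter.Eventually.of_forall ha))
  have hstep : ∀ (x : Space d) (k : ℕ), S (x + k • s, x + (k + 1) • s) = S (x, x + s) :=
    fun x k => by
      rw [succ_nsmul', ← add_assoc]
      exact shift_apply hS r _ _ k
  have hext : ∀ m, IsExtremalSegment S m fun k => a + k • s := by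
    intro m k _
    have h1 := partialTwo_periodic hS (k • r) a (a + s)
    have h2 := partialOne_periodic hS ((k + 1) • r) a (a + s)
    rw [map_nsmul, ← hs, add_assoc, ← succ_nsmul'] at h1 h2
    rw [h1, h2]
    exact hcrit
  -- The competitor jumps from `a` to `b + s`, makes `m` steps along `b + k s`, and jumps back to `a
  -- + (m + 2) s`. The cost of the two jumps does not depend on `m`.
  have hle : ∀ m : ℕ, (m + 2) * S (a, a + s) ≤
      (S (a, b + s) + S (b, a + s)) + m * S (b, b + s) := by
    intro m
    let Y : ℕ → Space d := fun k => (if k = 0 ∨ k = m + 2 then a else b) + k • s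
    have h := (hext (m + 1)).action_le hF (Y := Y) (by simp [Y]) (by simp [Y])
    have hY : action S (m + 1 + 1) Y =
        (S (a, b + s) + S (b, a + s)) + m * S (b, b + s) := by
      have hmid : ∀ k ∈ Finset.range m, S (Y (k + 1), Y (k + 1 + 1)) = S (b, b + s) := by
        intro k hk
        rw [Finset.mem_range] at hk
        have e1 : Y (k + 1) = b + (k + 1) • s := by
          simp only [Y]
          rw [if_neg (by omega)]
        have e2 : Y (k + 1 + 1) = b + (k + 1 + 1) • s := by
          simp only [Y]
          rw [if_neg (by omega)]
        rw [e1, e2, hstep]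
      have e0 : Y 0 = a := by simp [Y]
      have e1 : Y 1 = b + s := by simp [Y]
      have e2 : Y (m + 1) = b + (m + 1) • s := by simp [Y]
      have e3 : Y (m + 1 + 1) = a + s + (m + 1) • s := by
        rw [add_assoc a, ← succ_nsmul']
        simp [Y]
      rw [action, Finset.sum_range_succ, Finset.sum_range_succ', Finset.sum_congr rfl hmid, e0,
        zero_add, e1, e2, e3, hs, shift_apply hS]
      simp
      ring
    have hX : action S (m + 1 + 1) (fun k => a + k • s) = (m + 2) * S (a, a + s) := by
      simp only [action, hstep, Finset.sum_const, Finset.card_range, nsmul_eq_mul]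
      push_cast
      ring
    rwa [hX, hY] at h
  have hab : S (a, a + s) ≤ S (b, b + s) := by
    by_contra! hlt
    obtain ⟨m, hm⟩ := exists_nat_gt
      ((S (a, b + s) + S (b, a + s) - 2 * S (a, a + s)) / (S (a, a + s) - S (b, b + s)))
    rw [div_lt_iff₀ (sub_pos.2 hlt)] at hm
    have := hle m
    linarith
  have h1 := ha x
  have h2 := ha y
  have h3 := hb x
  have h4 := hb y
  linarith

/-- Since `S (x, x)` is constant, every point is critical for it. -/
theorem NoConjugatePoints.isExtremal_const {hS : IsGeneratingFunction S}
    (hF : NoConjugatePoints hS) (c : Space d) : IsExtremal S fun _ => c := by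
  intro n
  have h := partialOne_add_partialTwo_eq_zero_of_isLocalExtr hS (s := 0) (x := c)
    (Or.inl (Filter.Eventually.of_forall fun y => by
      have := hF.apply_add_intVec_eq 0 c y
      rw [map_zero] at this
      exact this.le))
  simpa using h

/-- An extremal sequence which takes the same value `c` at two consecutive times is constant, if
the constant sequence `c` is extremal. -/
theorem IsExtremal.eq_const (hS : IsGeneratingFunction S) {x : ℤ → Space d}
    (hx : IsExtremal S x) {c : Space d} (hc : IsExtremal S fun _ => c) {i : ℤ}
    (h0 : x i = c) (h1 : x (i + 1) = c) (n : ℤ) : x n = c := by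
  have hc' := hc 0
  -- Two consecutive values determine the sequence, forwards by injectivity of `∂₁S(c, ·)` and
  -- backwards by that of `∂₂S(·, c)`.
  have h : x n = c ∧ x (n + 1) = c := by
    induction n using Int.inductionOn' (b := i) with
    | zero => exact ⟨h0, h1⟩
    | succ k _ ih =>
      refine ⟨ih.2, (bijective_partialOne hS c).1 ?_⟩
      have h2 := hx (k + 1)
      rw [add_sub_cancel_right, ih.1, ih.2, ← hc'] at h2
      exact add_left_cancel h2
    | pred k _ ih =>
      rw [sub_add_cancel]
      refine ⟨(bijective_partialTwo hS c).1 ?_, ih.1⟩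
      have h2 := hx k
      rw [ih.1, ih.2, ← hc'] at h2
      exact add_right_cancel h2
  exact h.1

theorem NoConjugatePoints.injective_or_const {hS : IsGeneratingFunction S}
    (hF : NoConjugatePoints hS) {x : ℤ → Space d} (hx : IsExtremal S x) :
    Function.Injective x ∨ ∃ c, ∀ n, x n = c := by
  rw [or_iff_not_imp_left]
  intro hinj
  obtain ⟨i, m, him⟩ : ∃ (i : ℤ) (m : ℕ), x i = x (i + (m + 1 : ℕ)) := by
    have key : ∀ i j : ℤ, i < j → x i = x j → ∃ (i : ℤ) (m : ℕ), x i = x (i + (m + 1 : ℕ)) := by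
      intro i j hij h
      refine ⟨i, (j - i - 1).toNat, ?_⟩
      rw [h]
      congr 1
      omega
    simp only [Function.Injective, not_forall] at hinj
    obtain ⟨i, j, h, hne⟩ := hinj
    rcases lt_or_gt_of_ne hne with hij | hij
    · exact key i j hij h
    · exact key j i hij h.symm
  have hc := hF.isExtremal_const (x i)
  -- The segment between two equal values has the ends of a constant extremal segment; agreement at
  -- index `1` gives two equal consecutive values.
  have h := (hx.isExtremalSegment i m).eq hF (Y := fun _ => x i) (hc.isExtremalSegment i m)
    (by simp) him.symm 1 (by omega)
  exact ⟨x i, hx.eq_const hS hc rfl (by simpa using h)⟩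

end Main

end TwistMap

end

theorem corollary2p5 (d : ℕ) (hd : 1 ≤ d)
    (S : TwistMap.Space d × TwistMap.Space d → ℝ)
    (hS : TwistMap.IsGeneratingFunction S)
    (hF : TwistMap.NoConjugatePoints hS) :
    (∀ c : TwistMap.Space d, TwistMap.IsExtremal S (fun _ => c)) ∧
    (∀ x : ℤ → TwistMap.Space d, TwistMap.IsExtremal S x →
      Function.Injective x ∨ ∃ c : TwistMap.Space d, ∀ n : ℤ, x n = c) ∧
    (∀ (r : Fin d → ℤ) (x y : TwistMap.Space d),
      S (x, x + TwistMap.intVec d r) = S (y, y + TwistMap.intVec d r)) :=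
  ⟨hF.isExtremal_const, fun _ => hF.injective_or_const, hF.apply_add_intVec_eq⟩
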